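/- **Setting.** Let $\mathcal N$ (edges), $\mathcal L$ (tasks) and $\mathcal P$ (availability states) be finite sets. Each edge $n$ has a task $l(n)$, and in state $p$ an availability indicator $x_n^p\in\{0,1\}$; put $x_l^p=\sum_{n:\,l(n)=l}x_n^p$. If task $l$ is selected in state $p$, it takes up amounts $b_l^p$, $o_l^p$, $c_l^p\in\mathbb R$ of bandwidth, memory and computing resources (arbitrary given numbers, e.g. proportional to $x_l^p$). For limits $B,O,C\in\mathbb R$ let $$\mathcal F_p=\Big\{q\in\{0,1\}^{\mathcal L}:\ \sum_l q_l b_l^p\le B,\ \sum_l q_l o_l^p\le O,\ \sum_l q_l c_l^p\le C\Big\}.$$ Let $X_l\in\mathbb R\cup\{-\infty\}$, and let the utilities $V_l:[0,\infty)\to\mathbb R\cup\{-\infty\}$ be nondecreasing, concave and continuous, and finite on $(0,\infty)$ (for example $V_l=\log$). The states $p^{(r)}$, $r=1,2,\dots$, form a stationary ergodic process with marginal probabilities $\phi^p$. For $Q=(q^p)_{p}$ let $a_l(Q)=\sum_p\phi^p q_l^p x_l^p$. The *task selection problem* is to maximize $\sum_l V_l(a_l(Q))$ subject to $q^p\in\mathcal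 F_p$ for all $p$ and $a_l(Q)\ge X_l$ for all $l$. Its *relaxation* allows time sharing, that is, $q^p\in\operatorname{conv}\mathcal F_p$ instead of $q^p\in\mathcal F_p$. Assume strict feasibility: there is $Q$ with $q^p\in\operatorname{conv}\mathcal F_p$ for all $p$ and $a_l(Q)>X_l$, $a_l(Q)>0$ for all $l$. **Algorithm.** Let $\alpha^{(r)}>0$ be nonincreasing step sizes with $\alpha^{(r)}\to0$ and $r\alpha^{(r)}$ nondecreasing (for example $c\,r^{-\beta}$ with $c>0$, $0<\beta\le1$). A run starts from any $\lambda_l^{(1)},\mu_l^{(1)}\ge0$, and in round $r$, with $x_l^{(r)}=x_l^{p^{(r)}}$, takes $$q^{(r)}\in\operatorname*{argmax}_{q\in\mathcal F_{p^{(r)}}}\sum_l(\lambda_l^{(r)}+\mu_l^{(r)})\,q_l x_l^{(r)},\qquad y_l^{(r)}=\operatorname*{argmax}_{y\ge0}\{V_l(y)-\lambda_l^{(r)}y\},$$ $$\lambda_l^{(r+1)}=\big[\lambda_l^{(r)}-\alpha^{(r)}(q_l^{(r)}x_l^{(r)}-y_l^{(r)})\big]^+,\qquad \mu_l^{(r+1)}=\big[\mu_l^{(r)}-\alpha^{(r)}(q_l^{(r)}x_l^{(r)}-X_l)\big]^+$$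 (so $\mu_l^{(r+1)}=0$ if $X_l=-\infty$). Ties in $q^{(r)}$ are broken arbitrarily, and ties in $y_l^{(r)}$ by a fixed function of $\lambda_l^{(r)}$; it is part of the notion of a run that the maximizers $y_l^{(r)}$ exist. **Theorem.** The algorithm optimally solves the task selection problem in the long run: the relaxation has a maximum value $U^*\in\mathbb R\cup\{-\infty\}$, which is at least $\sum_l V_l(a_l(Q))$ for every feasible point $Q$ of the task selection problem itself, and almost surely every run, whose selections respect the resource limits in each round, has time averages $\bar a_l^{R}=\frac1R\sum_{r=1}^R q_l^{(r)}x_l^{(r)}$ that satisfy $$\liminf_{R\to\infty}\bar a_l^{R}\ \ge\ X_l\quad\text{for all }l,\qquad\text{and}\qquad \lim_{R\to\infty}\sum_l V_l(\bar a_l^{R})=U^*.$$ -/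

import Mathlib

open MeasureTheory Filter Topology Set

noncomputable section

/-- Data of the task selection problem: edges `N`, tasks `L`, availability states `P`.
`bandwidth p l`, `memory p l`, `compute p l` are the amounts of the three cloud resources that task
`l` takes up if it is selected in state `p` (for instance `x_l^p * B_l` with a requirement `B_l` per
participating edge). `X l = ⊥` means that task `l` has no minimum-participation constraint.
A utility may take the value `⊥`, as the logarithm does at `0`. -/
structure TaskModel (N L P : Type*) where
  /-- the task of each edge -/
  task : N → L
  /-- availability indicator of each edge in each state -/
  avail : P → N → Bool
  bandwidth : P → L → ℝ
  memory : P → L → ℝ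
  compute : P → L → ℝ
  maxBandwidth : ℝ
  maxMemory : ℝ
  maxCompute : ℝ
  /-- required minimum average number of participants -/
  X : L → WithBot ℝ
  /-- utility of an average number of participants -/
  V : L → ℝ → EReal

/-- A utility function on `[0, ∞)`: nondecreasing, concave and continuous, finite except possibly
for the value `-∞` at `0`. -/
structure IsUtility (v : ℝ → EReal) : Prop where
  ne_top : ∀ u, 0 ≤ u → v u ≠ ⊤
  ne_bot : ∀ u, 0 < u → v u ≠ ⊥
  mono : MonotoneOn v (Ici 0)
  concave : ∀ u w a b : ℝ, 0 ≤ u → 0 ≤ w → 0 ≤ a → 0 ≤ b → a + b = 1 →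
    (a : EReal) * v u + (b : EReal) * v w ≤ v (a * u + b * w)
  continuousOn : ContinuousOn v (Ici 0)

namespace TaskModel

variable {N L P : Type*} (M : TaskModel N L P)

/-- `x_l^p`, the number of available edges with task `l` in state `p`. -/
def x (p : P) (l : L) : ℝ := (Nat.card {n : N // M.task n = l ∧ M.avail p n = true} : ℝ)

/-- The selections `q ∈ {0,1}^L` that respect the three resource limits in state `p`. -/
def Selections [Fintype L] (p : P) : Set (L → ℝ) :=
  {q | (∀ l, q l = 0 ∨ q l = 1) ∧
    ∑ l, q l * M.bandwidth p l ≤ M.maxBandwidth ∧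
    ∑ l, q l * M.memory p l ≤ M.maxMemory ∧
    ∑ l, q l * M.compute p l ≤ M.maxCompute}

/-- Average number of participants of task `l` under `Q = (q^p)_p` and state probabilities `φ`. -/
def avgParticipants [Fintype P] (φ : P → ℝ) (Q : P → L → ℝ) (l : L) : ℝ :=
  ∑ p, φ p * Q p l * M.x p l

/-- The objective `∑_l V_l(a_l)` at a vector `a` of average numbers of participants. -/
def utility [Fintype L] (a : L → ℝ) : EReal := ∑ l, M.V l (a l)

/-- Feasibility of `Q` in the task selection problem with selection indicators in `{0,1}`. -/
def IsFeasible [Fintype L] [Fintype P] (φ : P → ℝ) (Q : P → L → ℝ) : Prop :=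
  (∀ p, Q p ∈ M.Selections p) ∧ ∀ l, M.X l ≤ (M.avgParticipants φ Q l : WithBot ℝ)

/-- Feasibility of `Q` in the relaxed problem, in which `q^p` is the vector of selection frequencies
of a mixture (time sharing) of selections that respect the resource limits in state `p`. -/
def IsRelaxedFeasible [Fintype L] [Fintype P] (φ : P → ℝ) (Q : P → L → ℝ) : Prop :=
  (∀ p, Q p ∈ convexHull ℝ (M.Selections p)) ∧
    ∀ l, M.X l ≤ (M.avgParticipants φ Q l : WithBot ℝ)

/-- Strict feasibility: the relaxed problem has a point at which all minimum-participation
constraints are slack and every task has a positive average number of participants. -/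
def IsStrictlyFeasible [Fintype L] [Fintype P] (φ : P → ℝ) : Prop :=
  ∃ Q : P → L → ℝ, (∀ p, Q p ∈ convexHull ℝ (M.Selections p)) ∧
    ∀ l, M.X l < (M.avgParticipants φ Q l : WithBot ℝ) ∧ 0 < M.avgParticipants φ Q l

/-- The projected update `[m - α (c - X)]^+`; for `X = -∞` its value is `0`. -/
def multiplierUpdate (m α c : ℝ) : WithBot ℝ → ℝ
  | ⊥ => 0
  | (X : ℝ) => max 0 (m - α * (c - X))

/-- `(lam, mu, q)` is a run of the task selection algorithm with step sizes `α` along the state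
sequence `s`, where `Y l t` is the chosen maximizer of `V_l(u) - t u` over `u ≥ 0`, so that
`y_l^(r) = Y l (lam r l)`. Ties between optimal selections may be broken in any way. -/
structure IsRun [Fintype L] (α : ℕ → ℝ) (s : ℕ → P) (Y : L → ℝ → ℝ)
    (lam mu q : ℕ → L → ℝ) : Prop where
  lam_zero : ∀ l, 0 ≤ lam 0 l
  mu_zero : ∀ l, 0 ≤ mu 0 l
  select_mem : ∀ r, q r ∈ M.Selections (s r)
  select_max : ∀ r, ∀ q' ∈ M.Selections (s r),
    ∑ l, (lam r l + mu r l) * q' l * M.x (s r) l ≤ ∑ l, (lam r l + mu r l) * q r l * M.x (s r) l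
  aux_nonneg : ∀ r l, 0 ≤ Y l (lam r l)
  aux_max : ∀ r l, ∀ u, 0 ≤ u →
    M.V l u - ((lam r l * u : ℝ) : EReal) ≤
      M.V l (Y l (lam r l)) - ((lam r l * Y l (lam r l) : ℝ) : EReal)
  lam_succ : ∀ r l,
    lam (r + 1) l = max 0 (lam r l - α r * (q r l * M.x (s r) l - Y l (lam r l)))
  mu_succ : ∀ r l,
    mu (r + 1) l = multiplierUpdate (mu r l) (α r) (q r l * M.x (s r) l) (M.X l)

/-- The average number of participants of task `l` over the first `R` rounds. -/
def timeAverage (s : ℕ → P) (q : ℕ → L → ℝ) (R : ℕ) (l : L) : ℝ :=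
  (∑ r ∈ Finset.range R, q r l * M.x (s r) l) / R

end TaskModel

/-- Diminishing step sizes, such as `c / (r + 1) ^ β` with `0 < β ≤ 1`: positive, nonincreasing,
tending to zero, and not decreasing faster than the reciprocal of the round number. -/
structure IsStepSize (α : ℕ → ℝ) : Prop where
  pos : ∀ r, 0 < α r
  antitone : Antitone α
  tendsto_zero : Tendsto α atTop (𝓝 0)
  mul_mono : Monotone fun r : ℕ => ((r : ℝ) + 1) * α r

/-- The process `S` is stationary and ergodic: its law on the space of sequences is invariant and
ergodic under the shift. -/
def IsStationaryErgodic {Ω P : Type*} [MeasurableSpace Ω] [MeasurableSpace P]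
    (μ : Measure Ω) (S : ℕ → Ω → P) : Prop :=
  Ergodic (fun (s : ℕ → P) (r : ℕ) => s (r + 1)) (μ.map fun ω r => S r ω)

end

/-! The pair of multiplier vectors is a projected stochastic subgradient iterate for the dual of the
relaxed problem. The arrivals enter through a noise term: the indicator of the current state minus
its probability. Birkhoff's theorem gives, on almost every path, that this noise has small block
averages in the mean (`BlockNull`). Everything after that is deterministic on one path, so no
independence is needed and the exceptional null set does not depend on initial values or
tie-breaking.

The key property is flatness (`NoisySubgradient.flat`): for Lipschitz `U`, the averages of `(U (ν r)
- U (ν (r+1))) / α r` tend to zero. Since `r * α r` is monotone, there are two cases. If it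
diverges, a drift argument with a coercive dual (strict feasibility) shows that the iterates are of
smaller order than `r * α r`, and summation by parts suffices. If it converges, the iterates are
bounded but need not be small against `r * α r`; instead they barely move over stretches of bounded
total step size, because they keep returning close to dual minimizers and cannot leave a minimizer
quickly.

Flatness is used twice. For a coordinate `U` it says that the averaged constraint violations vanish:
participation is asymptotically at least `X`, and at least the averaged auxiliary variable. For a
smoothed norm `U` it is an averaged, radially weighted upper bound on the products of subgradients
and multipliers, the analogue of complementary slackness. The weight is needed because the
multipliers may be unbounded, so that noise multiplied by them is not controlled; coercivity shows
that the weight is rarely far from 1.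

Comparing each round with a feasible point (`le_inner_subgradient`) and applying Jensen's inequality
yields points `y` of almost optimal utility that are almost dominated by the time averages
(`exists_eventually_le`). Conversely, time averages are close to mixtures (`exists_mixture`), whose
limit points are feasible for the relaxation. Compactness and continuity of the extended-valued
utility turn both facts into convergence. -/

noncomputable section

/-! ### The pointwise ergodic theorem. -/

section Birkhoff

variable {X : Type*}

/-- The maximum of the first `n + 1` Birkhoff sums of `f`. -/
def maxBirkhoffSum (T : X → X) (f : X → ℝ) : ℕ → X → ℝ
  | 0, _ => 0
  | n + 1, x => max 0 (f x + maxBirkhoffSum T f n (T x))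

lemma maxBirkhoffSum_nonneg (T : X → X) (f : X → ℝ) (n : ℕ) (x : X) :
    0 ≤ maxBirkhoffSum T f n x := by
  cases n with
  | zero => exact le_rfl
  | succ n => exact le_max_left _ _

lemma maxBirkhoffSum_le_succ (T : X → X) (f : X → ℝ) (n : ℕ) (x : X) :
    maxBirkhoffSum T f n x ≤ maxBirkhoffSum T f (n + 1) x := by
  induction n generalizing x with
  | zero => exact le_max_left _ _
  | succ n ih => exact max_le_max le_rfl (add_le_add le_rfl (ih (T x)))

lemma birkhoffSum_le_maxBirkhoffSum (T : X → X) (f : X → ℝ) (n : ℕ) (x : X) :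
    birkhoffSum T f n x ≤ maxBirkhoffSum T f n x := by
  induction n generalizing x with
  | zero => simp [maxBirkhoffSum]
  | succ n ih =>
    rw [birkhoffSum_succ']
    exact (add_le_add le_rfl (ih (T x))).trans (le_max_right _ _)

lemma maxBirkhoffSum_le (T : X → X) {f : X → ℝ} {B : ℝ} (hB : ∀ x, |f x| ≤ B) (n : ℕ) (x : X) :
    maxBirkhoffSum T f n x ≤ n * B := by
  induction n generalizing x with
  | zero => simp [maxBirkhoffSum]
  | succ n ih =>
    have h0 : 0 ≤ B := (abs_nonneg _).trans (hB x)
    refine max_le (by positivity) ?_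
    have := ih (T x)
    have := (le_abs_self _).trans (hB x)
    push_cast
    linarith

lemma measurable_maxBirkhoffSum [MeasurableSpace X] {T : X → X} (hT : Measurable T)
    {f : X → ℝ} (hf : Measurable f) (n : ℕ) : Measurable (maxBirkhoffSum T f n) := by
  induction n with
  | zero => exact measurable_const
  | succ n ih => exact measurable_const.max (hf.add (ih.comp hT))

/-- The recursion bounds each of the two sequences by the other up to the finite term `f x`. This
makes the set of points with bounded maxima invariant, so ergodicity applies to it. -/
lemma bddAbove_maxBirkhoffSum_comp_iff (T : X → X) (f : X → ℝ) (x : X) :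
    BddAbove (range fun n => maxBirkhoffSum T f n (T x)) ↔
      BddAbove (range fun n => maxBirkhoffSum T f n x) := by
  constructor
  · rintro ⟨C, hC⟩
    refine ⟨max 0 (f x + C), ?_⟩
    rintro _ ⟨n, rfl⟩
    refine (maxBirkhoffSum_le_succ T f n x).trans ?_
    exact max_le_max le_rfl (add_le_add le_rfl (hC ⟨n, rfl⟩))
  · rintro ⟨C, hC⟩
    refine ⟨C - f x, ?_⟩
    rintro _ ⟨n, rfl⟩
    have h1 : maxBirkhoffSum T f (n + 1) x ≤ C := hC ⟨n + 1, rfl⟩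
    have h2 : f x + maxBirkhoffSum T f n (T x) ≤ maxBirkhoffSum T f (n + 1) x := le_max_right _ _
    show maxBirkhoffSum T f n (T x) ≤ C - f x
    linarith

variable [MeasurableSpace X] {ρ : Measure X} [IsProbabilityMeasure ρ]

/-- A form of the maximal ergodic theorem. -/
lemma Ergodic.ae_bddAbove_maxBirkhoffSum {T : X → X} (hT : Ergodic T ρ) {f : X → ℝ}
    (hf : Measurable f) {B : ℝ} (hB : ∀ x, |f x| ≤ B) (hneg : ∫ x, f x ∂ρ < 0) :
    ∀ᵐ x ∂ρ, BddAbove (range fun n => maxBirkhoffSum T f n x) := by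
  have hTm := hT.measurable
  have hMm := measurable_maxBirkhoffSum hTm hf
  have hMint : ∀ n, Integrable (maxBirkhoffSum T f n) ρ := fun n =>
    Integrable.of_bound (hMm n).aestronglyMeasurable (n * B) <| Eventually.of_forall fun x => by
      rw [Real.norm_eq_abs, abs_of_nonneg (maxBirkhoffSum_nonneg T f n x)]
      exact maxBirkhoffSum_le T hB n x
  set A : Set X := {x | BddAbove (range fun n => maxBirkhoffSum T f n x)} with hA
  have hAm : MeasurableSet A := measurableSet_bddAbove_range hMm
  have hAinv : T ⁻¹' A = A := by
    ext x
    exact bddAbove_maxBirkhoffSum_comp_iff T f x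
  rcases hT.toPreErgodic.ae_empty_or_univ hAm hAinv with h | h
  · exfalso
    -- If the maxima are almost surely unbounded, the integrand is eventually `f x`. It also equals
    -- the maximum of index `n + 1` at `x` minus the maximum of index `n` at `T x`, so its integral
    -- is nonnegative by invariance and monotonicity. This contradicts a negative mean.
    have hlim : Tendsto (fun n => ∫ x, max (-maxBirkhoffSum T f n (T x)) (f x) ∂ρ) atTop
        (𝓝 (∫ x, f x ∂ρ)) := by
      refine tendsto_integral_of_dominated_convergence (fun _ => B) ?_ (integrable_const _) ?_ ?_
      · exact fun n => (((hMm n).comp hTm).neg.max hf).aestronglyMeasurable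
      · refine fun n => Eventually.of_forall fun x => ?_
        have h1 := maxBirkhoffSum_nonneg T f n (T x)
        have h2 := abs_le.1 (hB x)
        rw [Real.norm_eq_abs, abs_le]
        exact ⟨h2.1.trans (le_max_right _ _), max_le (by linarith [abs_nonneg (f x), hB x]) h2.2⟩
      · have h' : ∀ᵐ x ∂ρ, x ∉ A := by
          filter_upwards [h] with x hx
          intro hxA
          exact (hx.mp hxA : x ∈ (∅ : Set X))
        filter_upwards [h'] with x hx
        have hx' : ¬ BddAbove (range fun n => maxBirkhoffSum T f n (T x)) := by
          rw [bddAbove_maxBirkhoffSum_comp_iff]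
          exact hx
        have hmono : Monotone fun n => maxBirkhoffSum T f n (T x) :=
          monotone_nat_of_le_succ fun n => maxBirkhoffSum_le_succ T f n (T x)
        have htop := tendsto_atTop_atTop_of_monotone hmono (fun b => by
          by_contra! hcon
          exact hx' ⟨b, by rintro _ ⟨n, rfl⟩; exact (hcon n).le⟩)
        refine tendsto_const_nhds.congr' ?_
        filter_upwards [htop.eventually_ge_atTop (-f x)] with n hn
        exact (max_eq_right (by linarith)).symm
    have hnonneg : ∀ n, 0 ≤ ∫ x, max (-maxBirkhoffSum T f n (T x)) (f x) ∂ρ := by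
      intro n
      have hcomp : ∫ x, maxBirkhoffSum T f n (T x) ∂ρ = ∫ x, maxBirkhoffSum T f n x ∂ρ := by
        rw [← integral_map hTm.aemeasurable (hMm n).aestronglyMeasurable,
          hT.map_eq]
      have hci : Integrable (fun x => maxBirkhoffSum T f n (T x)) ρ :=
        hT.toMeasurePreserving.integrable_comp_of_integrable (hMint n)
      have heq : ∀ x, max (-maxBirkhoffSum T f n (T x)) (f x) =
          maxBirkhoffSum T f (n + 1) x - maxBirkhoffSum T f n (T x) := fun x => by
        show _ = max 0 (f x + maxBirkhoffSum T f n (T x)) - _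
        rw [← max_sub_sub_right]
        congr 1 <;> ring
      simp_rw [heq]
      rw [integral_sub (hMint _) hci, hcomp, sub_nonneg]
      exact integral_mono (hMint _) (hMint _) (fun x => maxBirkhoffSum_le_succ T f n x)
    exact absurd (ge_of_tendsto' hlim hnonneg) (not_le.2 hneg)
  · filter_upwards [h] with x hx
    exact hx.mpr (mem_univ x)

/-- For `c'` strictly between the mean and `c`, the sums of `f - c'` are bounded above by the
maximal theorem, and `n * (c - c')` eventually absorbs the bound. -/
lemma Ergodic.ae_eventually_birkhoffSum_le {T : X → X} (hT : Ergodic T ρ) {f : X → ℝ}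
    (hf : Measurable f) {B : ℝ} (hB : ∀ x, |f x| ≤ B) {c : ℝ} (hc : ∫ x, f x ∂ρ < c) :
    ∀ᵐ x ∂ρ, ∀ᶠ n : ℕ in atTop, (∑ k ∈ Finset.range n, f (T^[k] x)) / n ≤ c := by
  obtain ⟨c', h1, h2⟩ := exists_between hc
  have hfi : Integrable f ρ := Integrable.of_bound hf.aestronglyMeasurable B (Eventually.of_forall hB)
  have hneg : ∫ x, (f x - c') ∂ρ < 0 := by
    rw [integral_sub hfi (integrable_const _)]
    simpa using h1
  have hb : ∀ x, |f x - c'| ≤ B + |c'| := fun x =>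
    (abs_sub _ _).trans (add_le_add (hB x) le_rfl)
  filter_upwards [hT.ae_bddAbove_maxBirkhoffSum (hf.sub_const c') hb hneg] with x hx
  obtain ⟨C, hC⟩ := hx
  have hlim : Tendsto (fun n : ℕ => (n : ℝ) * (c - c')) atTop atTop :=
    tendsto_natCast_atTop_atTop.atTop_mul_const (sub_pos.2 h2)
  filter_upwards [hlim.eventually_ge_atTop C, eventually_gt_atTop 0] with n hn hn0
  have h3 := (birkhoffSum_le_maxBirkhoffSum T (fun x => f x - c') n x).trans (hC ⟨n, rfl⟩)
  rw [birkhoffSum, Finset.sum_sub_distrib, Finset.sum_const, Finset.card_range, nsmul_eq_mul] at h3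
  rw [div_le_iff₀ (by exact_mod_cast hn0)]
  linarith

/-- Birkhoff's pointwise ergodic theorem for bounded functions. -/
lemma Ergodic.ae_tendsto_birkhoffSum_div {T : X → X} (hT : Ergodic T ρ) {f : X → ℝ}
    (hf : Measurable f) {B : ℝ} (hB : ∀ x, |f x| ≤ B) :
    ∀ᵐ x ∂ρ, Tendsto (fun n : ℕ => (∑ k ∈ Finset.range n, f (T^[k] x)) / n) atTop
      (𝓝 (∫ x, f x ∂ρ)) := by
  have hup : ∀ j : ℕ, ∀ᵐ x ∂ρ, ∀ᶠ n : ℕ in atTop,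
      (∑ k ∈ Finset.range n, f (T^[k] x)) / n ≤ ∫ x, f x ∂ρ + 1 / ((j : ℝ) + 1) := fun j =>
    hT.ae_eventually_birkhoffSum_le hf hB (lt_add_of_pos_right _ Nat.one_div_pos_of_nat)
  have hlo : ∀ j : ℕ, ∀ᵐ x ∂ρ, ∀ᶠ n : ℕ in atTop,
      (∑ k ∈ Finset.range n, -f (T^[k] x)) / n ≤ -∫ x, f x ∂ρ + 1 / ((j : ℝ) + 1) := fun j => by
    refine hT.ae_eventually_birkhoffSum_le (f := fun x => -f x) hf.neg (B := B)
      (fun x => by rw [abs_neg]; exact hB x) ?_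
    rw [integral_neg]
    exact lt_add_of_pos_right _ Nat.one_div_pos_of_nat
  filter_upwards [ae_all_iff.2 hup, ae_all_iff.2 hlo] with x h1 h2
  rw [Metric.tendsto_nhds]
  intro ε hε
  obtain ⟨j, hj⟩ := exists_nat_one_div_lt hε
  filter_upwards [h1 j, h2 j] with n hn1 hn2
  rw [Finset.sum_neg_distrib, neg_div] at hn2
  rw [Real.dist_eq, abs_lt]
  constructor <;> linarith

end Birkhoff

/-! ### Vanishing block averages of the state process. -/

/-- The averages of `z` over blocks of `K` consecutive rounds are small in the mean if `K` is
large. -/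
def BlockNull (z : ℕ → ℝ) : Prop :=
  ∀ η : ℝ, 0 < η → ∃ K : ℕ, 0 < K ∧ ∀ᶠ R : ℕ in atTop,
    (∑ r ∈ Finset.range R, |(∑ k ∈ Finset.range K, z (r + k)) / K|) / R ≤ η

open Classical in
/-- The deviation of the indicator of state `p` in round `r` from its probability. -/
def stateDeviation {P : Type*} (φ : P → ℝ) (s : ℕ → P) (p : P) (r : ℕ) : ℝ :=
  (if s r = p then 1 else 0) - φ p

/-- Birkhoff's theorem is used twice: with dominated convergence, the integral of the absolute
`K`-block average tends to zero as `K` grows; for fixed `K`, the mean over starting rounds converges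
to that integral. -/
lemma Ergodic.ae_blockNull {X : Type*} [MeasurableSpace X] {ρ : Measure X} [IsProbabilityMeasure ρ]
    {T : X → X} (hT : Ergodic T ρ) {f : X → ℝ} (hf : Measurable f) {B : ℝ} (hB : ∀ x, |f x| ≤ B)
    (h0 : ∫ x, f x ∂ρ = 0) : ∀ᵐ x ∂ρ, BlockNull fun r => f (T^[r] x) := by
  set F : ℕ → X → ℝ := fun K x => |(∑ k ∈ Finset.range K, f (T^[k] x)) / K| with hF
  have hFm : ∀ K, Measurable (F K) := fun K => by
    refine Measurable.abs (Measurable.div_const ?_ _)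
    exact Finset.measurable_sum _ fun k _ => hf.comp (hT.measurable.iterate k)
  have hFB : ∀ K x, |F K x| ≤ B := by
    intro K x
    have hB0 : 0 ≤ B := (abs_nonneg _).trans (hB x)
    rw [hF, abs_abs, abs_div, Nat.abs_cast]
    refine div_le_of_le_mul₀ (by positivity) hB0 ?_
    refine (Finset.abs_sum_le_sum_abs _ _).trans ?_
    refine (Finset.sum_le_sum fun k _ => hB (T^[k] x)).trans ?_
    simp [mul_comm]
  have hlim : Tendsto (fun K => ∫ x, F K x ∂ρ) atTop (𝓝 0) := by
    have : Tendsto (fun K => ∫ x, F K x ∂ρ) atTop (𝓝 (∫ _, (0 : ℝ) ∂ρ)) := by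
      refine tendsto_integral_of_dominated_convergence (fun _ => B)
        (fun K => (hFm K).aestronglyMeasurable) (integrable_const _)
        (fun K => Eventually.of_forall (hFB K)) ?_
      filter_upwards [hT.ae_tendsto_birkhoffSum_div hf hB] with x hx
      rw [h0] at hx
      simpa using hx.abs
    simpa using this
  have hall := ae_all_iff.2 fun K => hT.ae_tendsto_birkhoffSum_div (hFm K) (hFB K)
  filter_upwards [hall] with x hx η hη
  obtain ⟨K, hK1, hK2⟩ := ((hlim.eventually_lt_const hη).and (eventually_gt_atTop 0)).exists
  refine ⟨K, hK2, ?_⟩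
  filter_upwards [(hx K).eventually_lt_const hK1] with R hR
  refine le_trans (le_of_eq ?_) hR.le
  simp only [hF, ← Function.iterate_add_apply, add_comm]

lemma ae_blockNull_stateDeviation {P Ω : Type*} [Fintype P] [MeasurableSpace P]
    [MeasurableSingletonClass P] [MeasurableSpace Ω] (μ : Measure Ω) [IsProbabilityMeasure μ]
    (S : ℕ → Ω → P) (hS : ∀ r, Measurable (S r)) (hSE : IsStationaryErgodic μ S)
    (φ : P → ℝ) (hφ : ∀ p, φ p = μ.real {ω | S 0 ω = p}) :
    ∀ᵐ ω ∂μ, ∀ p, BlockNull (stateDeviation φ (fun r => S r ω) p) := by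
  classical
  have hpath : Measurable fun ω r => S r ω := measurable_pi_iff.2 hS
  have hprob : IsProbabilityMeasure (μ.map fun ω r => S r ω) :=
    Measure.isProbabilityMeasure_map hpath.aemeasurable
  rw [ae_all_iff]
  intro p
  set f : (ℕ → P) → ℝ := fun s => stateDeviation φ s p 0 with hf
  have hset : MeasurableSet {s : ℕ → P | s 0 = p} :=
    measurableSet_eq_fun (measurable_pi_apply 0) measurable_const
  have hfm : Measurable f :=
    (Measurable.ite hset measurable_const measurable_const).sub_const _
  have hφ1 : φ p ∈ Icc (0 : ℝ) 1 := by
    rw [hφ]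
    exact ⟨measureReal_nonneg, measureReal_le_one⟩
  have hfB : ∀ s, |f s| ≤ 1 := fun s => by
    simp only [hf, stateDeviation]
    rw [abs_le]
    split_ifs <;> constructor <;> linarith [hφ1.1, hφ1.2]
  have hint : ∫ s, f s ∂(μ.map fun ω r => S r ω) = 0 := by
    rw [integral_map hpath.aemeasurable hfm.aestronglyMeasurable]
    simp only [hf, stateDeviation]
    have hs : MeasurableSet {ω | S 0 ω = p} := measurableSet_eq_fun (hS 0) measurable_const
    have : (fun ω => (if S 0 ω = p then (1 : ℝ) else 0)) = indicator {ω | S 0 ω = p} 1 := by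
      ext ω
      simp [indicator]
    rw [integral_sub, this, integral_indicator_one hs, hφ]
    · simp
    · rw [this]
      exact (integrable_const (1 : ℝ)).indicator hs
    · exact integrable_const _
  have hae := Ergodic.ae_blockNull hSE hfm hfB hint
  have := ae_of_ae_map hpath.aemeasurable hae
  filter_upwards [this] with ω hω
  have hit : ∀ (r : ℕ) (s : ℕ → P),
      (fun (s : ℕ → P) (r : ℕ) => s (r + 1))^[r] s = fun k => s (k + r) := by
    intro r
    induction r with
    | zero => intro s; rfl
    | succ r ih =>
      intro s
      rw [Function.iterate_succ_apply, ih]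
      ext k
      simp only [add_assoc]
  convert hω using 2 with r
  simp [hf, hit, stateDeviation]

/-! ### Cesàro null sequences and summation by parts against step sizes. -/

section Sequences

/-- The averages of the first `R` terms of `b` tend to zero. -/
def CesaroNull (b : ℕ → ℝ) : Prop :=
  Tendsto (fun R : ℕ => (∑ r ∈ Finset.range R, b r) / R) atTop (𝓝 0)

lemma CesaroNull.add {a b : ℕ → ℝ} (ha : CesaroNull a) (hb : CesaroNull b) :
    CesaroNull fun r => a r + b r := by
  have := Tendsto.add ha hb
  simpa only [CesaroNull, Finset.sum_add_distrib, add_div, add_zero] using this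

lemma CesaroNull.const_mul {b : ℕ → ℝ} (hb : CesaroNull b) (c : ℝ) :
    CesaroNull fun r => c * b r := by
  have := Tendsto.const_mul c hb
  simpa only [CesaroNull, ← Finset.mul_sum, mul_div_assoc, mul_zero] using this

lemma CesaroNull.neg {b : ℕ → ℝ} (hb : CesaroNull b) : CesaroNull fun r => -b r := by
  simpa using hb.const_mul (-1)

lemma CesaroNull.sub {a b : ℕ → ℝ} (ha : CesaroNull a) (hb : CesaroNull b) :
    CesaroNull fun r => a r - b r := by
  simpa only [sub_eq_add_neg] using ha.add hb.neg

lemma cesaroNull_of_tendsto_zero {b : ℕ → ℝ} (hb : Tendsto b atTop (𝓝 0)) : CesaroNull b := by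
  have := hb.cesaro
  simpa only [CesaroNull, div_eq_inv_mul] using this

lemma CesaroNull.sum {ι : Type*} (t : Finset ι) {b : ι → ℕ → ℝ} (hb : ∀ i ∈ t, CesaroNull (b i)) :
    CesaroNull fun r => ∑ i ∈ t, b i r := by
  have : Tendsto (fun R : ℕ => ∑ i ∈ t, (∑ r ∈ Finset.range R, b i r) / R) atTop
      (𝓝 (∑ i ∈ t, 0)) := tendsto_finsetSum t fun i hi => hb i hi
  simp only [Finset.sum_const_zero] at this
  refine this.congr fun R => ?_
  rw [← Finset.sum_div, Finset.sum_comm]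

lemma CesaroNull.congr {a b : ℕ → ℝ} (ha : CesaroNull a) (h : ∀ r, a r = b r) : CesaroNull b := by
  rwa [← funext h]

/-- A telescoping sum of a bounded sequence. -/
lemma cesaroNull_sub_shift {a : ℕ → ℝ} {B : ℝ} (hB : ∀ r, |a r| ≤ B) (k : ℕ) :
    CesaroNull fun r => a r - a (r + k) := by
  induction k with
  | zero => simp [CesaroNull]
  | succ k ih =>
    have h1 : CesaroNull fun r => a (r + k) - a (r + k + 1) := by
      have h2 : ∀ R, |∑ r ∈ Finset.range R, (a (r + k) - a (r + k + 1))| ≤ 2 * B := by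
        intro R
        have := Finset.sum_range_sub' (fun r => a (r + k)) R
        simp only [add_right_comm _ 1 k] at this
        rw [this]
        refine (abs_sub _ _).trans ?_
        linarith [hB (0 + k), hB (R + k)]
      refine squeeze_zero_norm (a := fun R : ℕ => 2 * B / R) (fun R => ?_)
        (tendsto_const_div_atTop_nhds_zero_nat _)
      rw [Real.norm_eq_abs, abs_div, Nat.abs_cast]
      exact div_le_div_of_nonneg_right (h2 R) (by positivity)
    refine (ih.add h1).congr fun r => ?_
    rw [add_assoc r k 1]
    ring

lemma tendsto_shift_sub {c : ℕ → ℝ} (hc : Tendsto (fun r => c (r + 1) - c r) atTop (𝓝 0)) (k : ℕ) :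
    Tendsto (fun r => c (r + k) - c r) atTop (𝓝 0) := by
  induction k with
  | zero => simp
  | succ k ih =>
    have := (hc.comp (tendsto_add_atTop_nat k)).add ih
    simp only [add_zero] at this
    refine this.congr fun r => ?_
    simp only [Function.comp, add_assoc]
    ring

/-- Averaging against bounded, slowly varying weights. -/
lemma BlockNull.cesaroNull_mul {z : ℕ → ℝ} (hz : BlockNull z) {Z : ℝ} (hZ : ∀ r, |z r| ≤ Z)
    {c : ℕ → ℝ} {B : ℝ} (hB : ∀ r, |c r| ≤ B)
    (hc : Tendsto (fun r => c (r + 1) - c r) atTop (𝓝 0)) : CesaroNull fun r => c r * z r := by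
  have hB0 : 0 ≤ B := (abs_nonneg _).trans (hB 0)
  have hZ0 : 0 ≤ Z := (abs_nonneg _).trans (hZ 0)
  -- For fixed `k` the noise may be shifted: shifting the whole product telescopes, and the
  -- remaining change of the weight tends to zero. Averaging over `k < K` replaces `z r` by its
  -- block average.
  have hshift : ∀ k, CesaroNull fun r => c r * z r - c r * z (r + k) := by
    intro k
    have h1 : CesaroNull fun r => c r * z r - c (r + k) * z (r + k) :=
      cesaroNull_sub_shift (a := fun r => c r * z r) (B := B * Z) (fun r => by
        rw [abs_mul]
        exact mul_le_mul (hB r) (hZ r) (abs_nonneg _) hB0) k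
    have h2 : CesaroNull fun r => (c (r + k) - c r) * z (r + k) := by
      refine cesaroNull_of_tendsto_zero ?_
      have := (tendsto_shift_sub hc k).abs.mul_const Z
      rw [abs_zero, zero_mul] at this
      refine squeeze_zero_norm (fun r => ?_) this
      rw [Real.norm_eq_abs, abs_mul]
      exact mul_le_mul_of_nonneg_left (hZ _) (abs_nonneg _)
    exact (h1.add h2).congr fun r => by ring
  rw [CesaroNull, Metric.tendsto_nhds]
  intro ε hε
  obtain ⟨K, hK, hev⟩ := hz (ε / (2 * (B + 1))) (by positivity)
  have hKr : (0 : ℝ) < K := by exact_mod_cast hK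
  have hmain : CesaroNull fun r => c r * z r - c r * ((∑ k ∈ Finset.range K, z (r + k)) / K) := by
    have := (CesaroNull.sum (Finset.range K) fun k _ => hshift k).const_mul (1 / K)
    refine this.congr fun r => ?_
    rw [Finset.sum_sub_distrib, Finset.sum_const, Finset.card_range, nsmul_eq_mul,
      ← Finset.mul_sum]
    field_simp
  have hmain' := (Metric.tendsto_nhds.1 hmain) (ε / 2) (by positivity)
  filter_upwards [hmain', hev] with R h1 h2
  rw [Real.dist_eq, sub_zero] at h1 ⊢
  rw [Finset.sum_sub_distrib, sub_div] at h1
  have h3 : |(∑ r ∈ Finset.range R, c r * ((∑ k ∈ Finset.range K, z (r + k)) / K)) / R| ≤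
      B * (ε / (2 * (B + 1))) := by
    refine le_trans ?_ (mul_le_mul_of_nonneg_left h2 hB0)
    rw [abs_div, Nat.abs_cast, ← mul_div_assoc]
    refine div_le_div_of_nonneg_right ?_ (by positivity)
    refine (Finset.abs_sum_le_sum_abs _ _).trans ?_
    rw [Finset.mul_sum]
    refine Finset.sum_le_sum fun r _ => ?_
    rw [abs_mul]
    exact mul_le_mul_of_nonneg_right (hB r) (abs_nonneg _)
  have h4 : B * (ε / (2 * (B + 1))) < ε / 2 := by
    rw [← mul_div_assoc, div_lt_div_iff₀ (by positivity) (by positivity)]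
    nlinarith
  have h5 := abs_lt.1 h1
  have h6 := abs_le.1 h3
  rw [abs_lt]
  constructor <;> linarith

variable {α : ℕ → ℝ}

/-- This is monotonicity of `(r + 1) * α r`, rearranged to bound the decrements of `α`, as summation
by parts requires. -/
lemma IsStepSize.succ_mul_le (hα : IsStepSize α) (r : ℕ) :
    ((r : ℝ) + 1) * (α r - α (r + 1)) ≤ α (r + 1) := by
  have := hα.mul_mono (Nat.le_succ r)
  simp only [Nat.succ_eq_add_one] at this
  push_cast at this
  linarith

/-- Weighted sums of a sequence with vanishing averages. -/
lemma CesaroNull.abs_sum_mul_le (hα : IsStepSize α) {b : ℕ → ℝ} (hb : CesaroNull b) {η : ℝ}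
    (hη : 0 < η) : ∃ r₀ : ℕ, ∀ m R, r₀ ≤ m → m ≤ R →
      |∑ r ∈ Finset.Ico m R, α r * b r| ≤
        η * (2 * (((R : ℝ) + 1) * α R) + ∑ r ∈ Finset.Ico m R, α r) := by
  obtain ⟨r₀, hr₀⟩ := eventually_atTop.1 ((Metric.tendsto_nhds.1 hb) η hη)
  refine ⟨r₀, fun m R hm hmR => ?_⟩
  set T : ℕ → ℝ := fun R => ∑ r ∈ Finset.range R, b r with hT
  have hTb : ∀ r, r₀ ≤ r → |T r| ≤ η * r := by
    intro r hr
    have := hr₀ r hr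
    rw [Real.dist_eq, sub_zero, abs_div, Nat.abs_cast] at this
    rcases Nat.eq_zero_or_pos r with rfl | h
    · simp [hT]
    · exact ((div_lt_iff₀ (by exact_mod_cast h)).1 this).le
  -- Abel summation: the partial sums are at most `η * r`, so the boundary terms cost `η` times `(r
  -- + 1) * α r`, and by `succ_mul_le` each decrement costs at most `η * α r`.
  have habel : ∀ R, m ≤ R → ∑ r ∈ Finset.Ico m R, α r * b r =
      α R * T R - α m * T m + ∑ r ∈ Finset.Ico m R, T (r + 1) * (α r - α (r + 1)) := by
    intro R hR
    induction R, hR using Nat.le_induction with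
    | base => simp
    | succ R hR ih =>
      rw [Finset.sum_Ico_succ_top hR, Finset.sum_Ico_succ_top hR, ih]
      have : T (R + 1) = T R + b R := Finset.sum_range_succ _ _
      rw [this]
      ring
  have hend : ∀ r, r₀ ≤ r → |α r * T r| ≤ η * (((r : ℝ) + 1) * α r) := by
    intro r hr
    rw [abs_mul, abs_of_pos (hα.pos r)]
    have := mul_le_mul_of_nonneg_left (hTb r hr) (hα.pos r).le
    nlinarith [hα.pos r]
  have hmid : ∀ r, r₀ ≤ r → |T (r + 1) * (α r - α (r + 1))| ≤ η * α r := by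
    intro r hr
    have hd : 0 ≤ α r - α (r + 1) := sub_nonneg.2 (hα.antitone (Nat.le_succ r))
    rw [abs_mul, abs_of_nonneg hd]
    have h1 := mul_le_mul_of_nonneg_right (hTb (r + 1) (hr.trans (Nat.le_succ r))) hd
    have h2 := hα.succ_mul_le r
    push_cast at h1
    nlinarith
  rw [habel R hmR]
  have h1 := hend R (hm.trans hmR)
  have h2 := hend m hm
  have h3 : |∑ r ∈ Finset.Ico m R, T (r + 1) * (α r - α (r + 1))| ≤
      η * ∑ r ∈ Finset.Ico m R, α r := by
    refine (Finset.abs_sum_le_sum_abs _ _).trans ?_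
    rw [Finset.mul_sum]
    exact Finset.sum_le_sum fun r hr => hmid r (hm.trans (Finset.mem_Ico.1 hr).1)
  have h4 : ((m : ℝ) + 1) * α m ≤ ((R : ℝ) + 1) * α R := hα.mul_mono hmR
  have h5 := mul_le_mul_of_nonneg_left h4 hη.le
  have h6 := abs_le.1 h1
  have h7 := abs_le.1 h2
  have h8 := abs_le.1 h3
  rw [abs_le]
  constructor <;> linarith

/-- The quotients `U r / α r` telescope to a boundary term that is negligible after division by `R`.
The correction carries `1 / α (r+1) - 1 / α r`, which is at most `2 / ((r + 2) * α (r+1))`. -/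
lemma flat_of_tendsto_div (hα : IsStepSize α) {U : ℕ → ℝ}
    (hU : Tendsto (fun r : ℕ => U r / (((r : ℝ) + 1) * α r)) atTop (𝓝 0)) :
    CesaroNull fun r => (U r - U (r + 1)) / α r := by
  have h1 : CesaroNull fun r => U r / α r - U (r + 1) / α (r + 1) := by
    have h2 : Tendsto (fun R : ℕ => U 0 / α 0 / R - (U R / (((R : ℝ) + 1) * α R)) *
        (((R : ℝ) + 1) / R)) atTop (𝓝 (0 - 0 * 1)) := by
      refine (tendsto_const_div_atTop_nhds_zero_nat _).sub (hU.mul ?_)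
      have : Tendsto (fun R : ℕ => 1 + 1 / (R : ℝ)) atTop (𝓝 (1 + 0)) :=
        tendsto_const_nhds.add tendsto_one_div_atTop_nhds_zero_nat
      rw [add_zero] at this
      refine this.congr' ?_
      filter_upwards [eventually_gt_atTop 0] with R hR
      have : (R : ℝ) ≠ 0 := by exact_mod_cast hR.ne'
      field_simp
    simp only [zero_mul, sub_zero] at h2
    refine h2.congr' ?_
    filter_upwards [eventually_gt_atTop 0] with R hR
    have hR' : (R : ℝ) ≠ 0 := by exact_mod_cast hR.ne'
    have hR1 : (R : ℝ) + 1 ≠ 0 := by positivity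
    rw [Finset.sum_range_sub' (fun r => U r / α r)]
    have := (hα.pos R).ne'
    have := (hα.pos 0).ne'
    field_simp
  have h3 : CesaroNull fun r => U (r + 1) * (1 / α (r + 1) - 1 / α r) := by
    refine cesaroNull_of_tendsto_zero ?_
    have h4 := ((hU.comp (tendsto_add_atTop_nat 1)).abs).const_mul 2
    rw [abs_zero, mul_zero] at h4
    refine squeeze_zero_norm (fun r => ?_) h4
    simp only [Function.comp]
    have p1 := hα.pos r
    have p2 := hα.pos (r + 1)
    have p3 := hα.antitone (Nat.le_succ r)
    have p4 := hα.succ_mul_le r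
    have hr : (0 : ℝ) ≤ r := Nat.cast_nonneg r
    have hnn : 0 ≤ 1 / α (r + 1) - 1 / α r := sub_nonneg.2 (one_div_le_one_div_of_le p2 p3)
    have hle : 1 / α (r + 1) - 1 / α r ≤ 2 / ((((r + 1 : ℕ) : ℝ) + 1) * α (r + 1)) := by
      have e : 1 / α (r + 1) - 1 / α r = (α r - α (r + 1)) / (α (r + 1) * α r) := by
        field_simp
      rw [e, div_le_div_iff₀ (by positivity) (by positivity)]
      push_cast
      have h7 : ((r : ℝ) + 1 + 1) * (α r - α (r + 1)) ≤ 2 * α r := by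
        simp only [Nat.succ_eq_add_one] at p3
        nlinarith
      nlinarith
    rw [Real.norm_eq_abs, abs_mul, abs_of_nonneg hnn, abs_div, abs_of_pos
      (show 0 < (((r + 1 : ℕ) : ℝ) + 1) * α (r + 1) by positivity)]
    calc _ ≤ |U (r + 1)| * (2 / ((((r + 1 : ℕ) : ℝ) + 1) * α (r + 1))) :=
          mul_le_mul_of_nonneg_left hle (abs_nonneg _)
      _ = _ := by ring
  refine (h1.add h3).congr fun r => ?_
  have := (hα.pos r).ne'
  have := (hα.pos (r + 1)).ne'
  field_simp
  ring

/-- Here `1 / α r` is asymptotically `(r + 1) / c`, and summing `(r + 1) * (U r - U (r+1))` by parts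
gives exactly the sum of `U r - U R`. -/
lemma flat_of_average_sub {c G : ℝ} (hc : 0 < c) (hα : IsStepSize α)
    (hαc : Tendsto (fun r : ℕ => ((r : ℝ) + 1) * α r) atTop (𝓝 c)) {U : ℕ → ℝ}
    (hstep : ∀ r, |U r - U (r + 1)| ≤ α r * G)
    (hU : Tendsto (fun R : ℕ => (∑ r ∈ Finset.range R, (U r - U R)) / R) atTop (𝓝 0)) :
    CesaroNull fun r => (U r - U (r + 1)) / α r := by
  have h1 : CesaroNull fun r => ((r : ℝ) + 1) * (U r - U (r + 1)) := by
    refine hU.congr fun R => ?_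
    congr 1
    induction R with
    | zero => simp
    | succ R ih =>
      rw [Finset.sum_range_succ, Finset.sum_range_succ (fun r : ℕ => ((r : ℝ) + 1) * (U r - U (r + 1))),
        ← ih]
      simp only [Finset.sum_sub_distrib, Finset.sum_const, Finset.card_range, nsmul_eq_mul]
      ring
  have h2 : CesaroNull fun r => (U r - U (r + 1)) / α r * (1 - ((r : ℝ) + 1) * α r / c) := by
    refine cesaroNull_of_tendsto_zero ?_
    have h3 : Tendsto (fun r : ℕ => G * |1 - ((r : ℝ) + 1) * α r / c|) atTop
        (𝓝 (G * |1 - c / c|)) := ((tendsto_const_nhds.sub (hαc.div_const c)).abs).const_mul G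
    rw [div_self hc.ne', sub_self, abs_zero, mul_zero] at h3
    refine squeeze_zero_norm (fun r => ?_) h3
    rw [Real.norm_eq_abs, abs_mul, abs_div, abs_of_pos (hα.pos r)]
    refine mul_le_mul_of_nonneg_right ?_ (abs_nonneg _)
    rw [div_le_iff₀ (hα.pos r)]
    linarith [hstep r]
  refine ((h1.const_mul (1 / c)).add h2).congr fun r => ?_
  have := (hα.pos r).ne'
  field_simp
  ring

end Sequences

/-! ### The soft norm and radial weights. -/

section Radial

variable {E : Type*} [NormedAddCommGroup E]

/-- A smooth approximation of the norm. -/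
def softNorm (H : ℝ) (v : E) : ℝ := √(H ^ 2 + ‖v‖ ^ 2)

/-- The radial weight `H / √(H ^ 2 + ‖v‖ ^ 2)`. -/
def radialWeight (H : ℝ) (v : E) : ℝ := H / softNorm H v

variable {H : ℝ}

lemma softNorm_pos (hH : 0 < H) (v : E) : 0 < softNorm H v := Real.sqrt_pos.2 (by positivity)

lemma norm_le_softNorm (v : E) : ‖v‖ ≤ softNorm H v :=
  Real.le_sqrt_of_sq_le (by nlinarith [sq_nonneg H])

lemma le_softNorm (v : E) : H ≤ softNorm H v :=
  Real.le_sqrt_of_sq_le (by nlinarith [sq_nonneg ‖v‖])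

lemma sq_softNorm (v : E) : softNorm H v ^ 2 = H ^ 2 + ‖v‖ ^ 2 :=
  Real.sq_sqrt (by positivity)

lemma softNorm_le (hH : 0 < H) (v : E) : softNorm H v ≤ H + ‖v‖ := by
  have := norm_nonneg v
  exact Real.sqrt_le_iff.2 ⟨by positivity, by nlinarith⟩

lemma radialWeight_pos (hH : 0 < H) (v : E) : 0 < radialWeight H v := div_pos hH (softNorm_pos hH v)

lemma radialWeight_le_one (hH : 0 < H) (v : E) : radialWeight H v ≤ 1 :=
  (div_le_one (softNorm_pos hH v)).2 (le_softNorm v)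

lemma radialWeight_mul_norm_le (hH : 0 < H) (v : E) : radialWeight H v * ‖v‖ ≤ H := by
  rw [radialWeight, div_mul_eq_mul_div, div_le_iff₀ (softNorm_pos hH v)]
  exact mul_le_mul_of_nonneg_left (norm_le_softNorm v) hH.le

lemma one_sub_radialWeight_le (hH : 0 < H) (v : E) :
    1 - radialWeight H v ≤ radialWeight H v * ‖v‖ / H := by
  have h0 := softNorm_pos hH v
  have h1 := softNorm_le hH v
  have e : radialWeight H v * ‖v‖ / H = ‖v‖ / softNorm H v := by
    rw [radialWeight]
    field_simp
  rw [e, radialWeight, one_sub_div h0.ne']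
  exact div_le_div_of_nonneg_right (by linarith) h0.le

lemma abs_softNorm_sub_le (hH : 0 < H) (u v : E) :
    |softNorm H u - softNorm H v| ≤ ‖u - v‖ := by
  have hu := softNorm_pos hH u
  have hv := softNorm_pos hH v
  have h1 : |softNorm H u - softNorm H v| * (softNorm H u + softNorm H v) ≤
      ‖u - v‖ * (softNorm H u + softNorm H v) := by
    have e1 : |softNorm H u - softNorm H v| * (softNorm H u + softNorm H v) =
        |‖u‖ - ‖v‖| * (‖u‖ + ‖v‖) := by
      rw [← abs_of_pos (add_pos hu hv), ← abs_mul,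
        ← abs_of_nonneg (add_nonneg (norm_nonneg u) (norm_nonneg v)), ← abs_mul]
      congr 1
      have := sq_softNorm (H := H) u
      have := sq_softNorm (H := H) v
      nlinarith
    rw [e1]
    exact mul_le_mul (abs_norm_sub_norm_le u v)
      (add_le_add (norm_le_softNorm u) (norm_le_softNorm v)) (by positivity) (norm_nonneg _)
  exact le_of_mul_le_mul_right h1 (add_pos hu hv)

lemma norm_radialWeight_smul_le [NormedSpace ℝ E] (hH : 0 < H) (v : E) : ‖radialWeight H v • v‖ ≤ H := by
  rw [norm_smul, Real.norm_of_nonneg (radialWeight_pos hH v).le]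
  exact radialWeight_mul_norm_le hH v

/-- Weighted iterates thus inherit slow variation while staying in a ball of radius `H`, which is
what averaging out the noise requires even when the iterates are unbounded. -/
lemma norm_radialWeight_smul_sub_le [NormedSpace ℝ E] (hH : 0 < H) (u v : E) :
    ‖radialWeight H u • u - radialWeight H v • v‖ ≤ 2 * ‖u - v‖ := by
  have e : radialWeight H u • u - radialWeight H v • v =
      radialWeight H u • (u - v) + (radialWeight H u - radialWeight H v) • v := by
    rw [smul_sub, sub_smul]
    abel
  have h1 : ‖radialWeight H u • (u - v)‖ ≤ ‖u - v‖ := by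
    rw [norm_smul, Real.norm_of_nonneg (radialWeight_pos hH u).le]
    exact mul_le_of_le_one_left (norm_nonneg _) (radialWeight_le_one hH u)
  have h2 : ‖(radialWeight H u - radialWeight H v) • v‖ ≤ ‖u - v‖ := by
    have hu := softNorm_pos hH u
    have hv := softNorm_pos hH v
    have e2 : radialWeight H u - radialWeight H v =
        radialWeight H u * ((softNorm H v - softNorm H u) / softNorm H v) := by
      rw [radialWeight, radialWeight]
      field_simp
    rw [norm_smul, Real.norm_eq_abs, e2, abs_mul, abs_of_pos (radialWeight_pos hH u), abs_div,
      abs_of_pos hv]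
    have h3 := abs_softNorm_sub_le hH v u
    rw [norm_sub_rev] at h3
    calc _ ≤ 1 * (‖u - v‖ / softNorm H v) * ‖v‖ := by
          gcongr
          exact radialWeight_le_one hH u
      _ = ‖u - v‖ * (‖v‖ / softNorm H v) := by ring
      _ ≤ ‖u - v‖ * 1 := by
          gcongr
          exact (div_le_one hv).2 (norm_le_softNorm v)
      _ = _ := mul_one _
  rw [e]
  linarith [norm_add_le (radialWeight H u • (u - v)) ((radialWeight H u - radialWeight H v) • v)]

/-- Concavity of the soft norm as a function of the squared norm. -/
lemma mul_softNorm_sub_le (hH : 0 < H) (u v : E) :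
    H * softNorm H u - H * softNorm H v ≤ radialWeight H v * ((‖u‖ ^ 2 - ‖v‖ ^ 2) / 2) := by
  have hv := softNorm_pos hH v
  have e : ‖u‖ ^ 2 - ‖v‖ ^ 2 = softNorm H u ^ 2 - softNorm H v ^ 2 := by
    rw [sq_softNorm, sq_softNorm]
    ring
  rw [e, radialWeight, div_mul_eq_mul_div, le_div_iff₀ hv]
  nlinarith [sq_nonneg (softNorm H u - softNorm H v)]

end Radial

/-! ### Noisy subgradient iterations: drift and growth. -/

section Subgradient

/-- Averaging noise against a Lipschitz function of a bounded, slowly varying sequence. -/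
lemma BlockNull.cesaroNull_mul_lipschitz {E : Type*} [NormedAddCommGroup E] {z : ℕ → ℝ}
    (hz : BlockNull z) (hZ : ∀ r, |z r| ≤ 1)
    {u : ℕ → E} {B : ℝ} (hB : ∀ r, ‖u r‖ ≤ B)
    (hu : Tendsto (fun r => ‖u (r + 1) - u r‖) atTop (𝓝 0)) {f : E → ℝ} {Lip : ℝ}
    (hf : ∀ u v, |f u - f v| ≤ Lip * ‖u - v‖) : CesaroNull fun r => z r * f (u r) := by
  have h1 := hu.const_mul Lip
  rw [mul_zero] at h1
  have hL : ∀ r, |f (u r)| ≤ |f 0| + |Lip| * B := fun r => by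
    have h2 := hf (u r) 0
    rw [sub_zero] at h2
    have h3 : |f (u r)| ≤ |f (u r) - f 0| + |f 0| := by
      simpa using abs_add_le (f (u r) - f 0) (f 0)
    have h4 : Lip * ‖u r‖ ≤ |Lip| * B :=
      mul_le_mul (le_abs_self _) (hB r) (norm_nonneg _) (abs_nonneg _)
    linarith
  refine (hz.cesaroNull_mul hZ hL (squeeze_zero_norm (fun r => ?_) h1)).congr
    fun r => mul_comm _ _
  exact hf _ _

variable {E P : Type*} [NormedAddCommGroup E] [InnerProductSpace ℝ E] [Fintype P]

open scoped InnerProductSpace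

/-- A projected subgradient iteration on the convex set `K` for the function `D`, in which the
subgradients are perturbed by `∑ p, z p r * h p (ν r)`, with a noise `z` of vanishing block
averages. -/
structure NoisySubgradient (α : ℕ → ℝ) (z : P → ℕ → ℝ) (K : Set E) (D : E → ℝ) (h : P → E → ℝ)
    (ν g : ℕ → E) (ε : ℕ → ℝ) (G Lip δ C : ℝ) : Prop where
  stepSize : IsStepSize α
  blockNull : ∀ p, BlockNull (z p)
  abs_le_one : ∀ p r, |z p r| ≤ 1
  isClosed : IsClosed K
  zero_mem : (0 : E) ∈ K
  mem : ∀ r, ν r ∈ K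
  step : ∀ r, ∀ θ ∈ K, ‖ν (r + 1) - θ‖ ^ 2 ≤ ‖ν r - α r • g r - θ‖ ^ 2
  norm_le : ∀ r, ‖g r‖ ≤ G
  continuous : Continuous D
  pos : 0 < δ
  coercive : ∀ v ∈ K, δ * ‖v‖ - C ≤ D v
  lipschitz : ∀ p u v, |h p u - h p v| ≤ Lip * ‖u - v‖
  homogeneous : ∀ p (t : ℝ) v, 0 ≤ t → h p (t • v) = t * h p v
  subgradient : ∀ r, ∀ θ ∈ K,
    D (ν r) - D θ + ∑ p, z p r * (h p (ν r) - h p θ) - ε r ≤ ⟪g r, ν r - θ⟫_ℝ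
  error : Tendsto ε atTop (𝓝 0)

namespace NoisySubgradient

variable {α : ℕ → ℝ} {z : P → ℕ → ℝ} {K : Set E} {D : E → ℝ} {h : P → E → ℝ}
  {ν g : ℕ → E} {ε : ℕ → ℝ} {G Lip δ C : ℝ}

lemma norm_sub_succ_le (hN : NoisySubgradient α z K D h ν g ε G Lip δ C) (r : ℕ) :
    ‖ν (r + 1) - ν r‖ ≤ α r * G := by
  have h1 := hN.step r (ν r) (hN.mem r)
  have e : ν r - α r • g r - ν r = -(α r • g r) := by abel
  rw [e, norm_neg] at h1
  have h2 := (pow_le_pow_iff_left₀ (norm_nonneg _) (norm_nonneg _) two_ne_zero).1 h1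
  rw [norm_smul, Real.norm_of_nonneg (hN.stepSize.pos r).le] at h2
  exact h2.trans (mul_le_mul_of_nonneg_left (hN.norm_le r) (hN.stepSize.pos r).le)

lemma tendsto_norm_sub_succ (hN : NoisySubgradient α z K D h ν g ε G Lip δ C) :
    Tendsto (fun r => ‖ν (r + 1) - ν r‖) atTop (𝓝 0) := by
  have := hN.stepSize.tendsto_zero.mul_const G
  rw [zero_mul] at this
  exact squeeze_zero (fun _ => norm_nonneg _) hN.norm_sub_succ_le this

lemma norm_sq_succ_le (hN : NoisySubgradient α z K D h ν g ε G Lip δ C) (r : ℕ) {θ : E}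
    (hθ : θ ∈ K) :
    ‖ν (r + 1) - θ‖ ^ 2 ≤
      ‖ν r - θ‖ ^ 2 + 2 * α r * (-⟪g r, ν r - θ⟫_ℝ + α r * (G ^ 2 / 2)) := by
  refine (hN.step r θ hθ).trans ?_
  have e : ν r - α r • g r - θ = (ν r - θ) - α r • g r := by abel
  rw [e, norm_sub_sq_real, inner_smul_right, real_inner_comm, norm_smul,
    Real.norm_of_nonneg (hN.stepSize.pos r).le, mul_pow]
  have h1 : ‖g r‖ ^ 2 ≤ G ^ 2 := pow_le_pow_left₀ (norm_nonneg _) (hN.norm_le r) 2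
  have h2 := mul_le_mul_of_nonneg_left h1 (sq_nonneg (α r))
  nlinarith

lemma map_zero (hN : NoisySubgradient α z K D h ν g ε G Lip δ C) (p : P) : h p 0 = 0 := by
  simpa using hN.homogeneous p 0 0 le_rfl

/-- The function `H * softNorm H` is concave in the squared norm, with derivative half the radial
weight. The one-step estimate of the squared norm, with comparison point 0, therefore carries over
with that weight. -/
lemma softNorm_succ_le (hN : NoisySubgradient α z K D h ν g ε G Lip δ C) {H : ℝ} (hH : 0 < H)
    (r : ℕ) :
    radialWeight H (ν r) * ⟪g r, ν r⟫_ℝ ≤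
      (H * softNorm H (ν r) - H * softNorm H (ν (r + 1))) / α r + α r * (G ^ 2 / 2) := by
  have hα := hN.stepSize.pos r
  have h1 := mul_softNorm_sub_le hH (ν (r + 1)) (ν r)
  have h2 := hN.norm_sq_succ_le r hN.zero_mem
  simp only [sub_zero] at h2
  have hw := radialWeight_pos hH (ν r)
  have hw1 := radialWeight_le_one hH (ν r)
  have h3 : radialWeight H (ν r) * ((‖ν (r + 1)‖ ^ 2 - ‖ν r‖ ^ 2) / 2) ≤
      radialWeight H (ν r) * (α r * (-⟪g r, ν r⟫_ℝ + α r * (G ^ 2 / 2))) :=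
    mul_le_mul_of_nonneg_left (by linarith) hw.le
  have h4 : radialWeight H (ν r) * (α r * (α r * (G ^ 2 / 2))) ≤ 1 * (α r * (α r * (G ^ 2 / 2))) :=
    mul_le_mul_of_nonneg_right hw1 (by positivity)
  rw [← sub_le_iff_le_add, le_div_iff₀ hα]
  nlinarith

/-- The noise, weighted by the radial weight. -/
lemma cesaroNull_noise (hN : NoisySubgradient α z K D h ν g ε G Lip δ C) {H : ℝ} (hH : 0 < H)
    {f : P → E → ℝ} {Lip' : ℝ} (hf : ∀ p u v, |f p u - f p v| ≤ Lip' * ‖u - v‖)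
    (hfh : ∀ p (t : ℝ) v, 0 ≤ t → f p (t • v) = t * f p v) :
    CesaroNull fun r => radialWeight H (ν r) * (∑ p, z p r * f p (ν r) - ε r) := by
  have h1 : CesaroNull fun r => ∑ p, z p r * f p (radialWeight H (ν r) • ν r) := by
    refine CesaroNull.sum _ fun p _ => ?_
    refine (hN.blockNull p).cesaroNull_mul_lipschitz (hN.abs_le_one p)
      (u := fun r => radialWeight H (ν r) • ν r)
      (fun r => norm_radialWeight_smul_le hH (ν r)) ?_ (hf p)
    have := hN.tendsto_norm_sub_succ.const_mul 2
    rw [mul_zero] at this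
    exact squeeze_zero (fun _ => norm_nonneg _)
      (fun r => norm_radialWeight_smul_sub_le hH _ _) this
  have h2 : CesaroNull fun r => radialWeight H (ν r) * ε r := by
    refine cesaroNull_of_tendsto_zero ?_
    have := hN.error.abs
    rw [abs_zero] at this
    refine squeeze_zero_norm (fun r => ?_) this
    rw [Real.norm_eq_abs, abs_mul, abs_of_pos (radialWeight_pos hH _)]
    exact mul_le_of_le_one_left (abs_nonneg _) (radialWeight_le_one hH _)
  refine (h1.sub h2).congr fun r => ?_
  rw [mul_sub, Finset.mul_sum]
  congr 1
  refine Finset.sum_congr rfl fun p _ => ?_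
  rw [hfh p _ _ (radialWeight_pos hH _).le]
  ring

lemma mul_coercive_le (hN : NoisySubgradient α z K D h ν g ε G Lip δ C) {H : ℝ} (hH : 0 < H)
    (r : ℕ) :
    radialWeight H (ν r) * (δ * ‖ν r‖ - (D 0 + C)) +
      radialWeight H (ν r) * (∑ p, z p r * h p (ν r) - ε r) ≤
        radialWeight H (ν r) * ⟪g r, ν r⟫_ℝ := by
  have h1 := hN.subgradient r 0 hN.zero_mem
  simp only [sub_zero, hN.map_zero] at h1
  have h2 := hN.coercive (ν r) (hN.mem r)
  rw [← mul_add]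
  exact mul_le_mul_of_nonneg_left (by linarith) (radialWeight_pos hH _).le

/-- Outside a ball, coercivity gives the soft norm a drift of at most `-δ/4` per unit of step size.
Since the last visit to the ball, only weighted sums of a Cesàro null error can push the iterate
outwards, and the part of these proportional to the total step size is absorbed by the drift. -/
lemma exists_norm_le (hN : NoisySubgradient α z K D h ν g ε G Lip δ C) {η : ℝ} (hη : 0 < η) :
    ∃ B : ℝ, ∀ R : ℕ, ‖ν R‖ ≤ B + η * (((R : ℝ) + 1) * α R) := by
  have hα := hN.stepSize
  have hδ := hN.pos
  set W : ℕ → ℝ := fun r => softNorm 1 (ν r) with hW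
  have hW0 : ∀ r, 0 ≤ W r := fun r => (softNorm_pos one_pos _).le
  set b : ℕ → ℝ := fun r =>
    α r * (G ^ 2 / 2) - radialWeight 1 (ν r) * (∑ p, z p r * h p (ν r) - ε r) with hb
  have hbn : CesaroNull b := by
    refine CesaroNull.sub (cesaroNull_of_tendsto_zero ?_)
      (hN.cesaroNull_noise one_pos hN.lipschitz hN.homogeneous)
    simpa using hα.tendsto_zero.mul_const (G ^ 2 / 2)
  have hstep : ∀ r, W (r + 1) - W r ≤
      α r * (radialWeight 1 (ν r) * (D 0 + C - δ * ‖ν r‖) + b r) := by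
    intro r
    have h1 := hN.softNorm_succ_le one_pos r
    have h2 := hN.mul_coercive_le one_pos r
    have h3 := h2.trans h1
    simp only [one_mul] at h3
    rw [← sub_le_iff_le_add, le_div_iff₀ (hα.pos r)] at h3
    simp only [hW, hb]
    nlinarith
  -- Beyond this radius `D 0 + C` is at most half of `δ * ‖ν r‖`, and norm at least 1 makes the
  -- weighted norm at least `1/2`.
  set N₀ : ℝ := max 1 (2 * (D 0 + C) / δ) with hN₀
  have hN₀1 : 1 ≤ N₀ := le_max_left _ _
  have hN₀2 : 2 * (D 0 + C) ≤ δ * N₀ := by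
    have : 2 * (D 0 + C) / δ ≤ N₀ := le_max_right _ _
    rw [div_le_iff₀ hδ] at this
    linarith
  have hdrift : ∀ r, N₀ ≤ ‖ν r‖ → W (r + 1) - W r ≤ α r * (-(δ / 4) + b r) := by
    intro r hr
    refine (hstep r).trans (mul_le_mul_of_nonneg_left ?_ (hα.pos r).le)
    have hw := radialWeight_pos one_pos (ν r)
    have h1 : D 0 + C - δ * ‖ν r‖ ≤ -(δ / 2 * ‖ν r‖) := by nlinarith
    have h2 := mul_le_mul_of_nonneg_left h1 hw.le
    have h3 : 1 / 2 ≤ radialWeight 1 (ν r) * ‖ν r‖ := by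
      rw [radialWeight, div_mul_eq_mul_div, le_div_iff₀ (softNorm_pos one_pos _)]
      have := softNorm_le one_pos (ν r)
      linarith
    nlinarith
  set η' : ℝ := min (δ / 4) (η / 2) with hη'
  have hη'0 : 0 < η' := lt_min (by positivity) (by positivity)
  obtain ⟨r₀, hr₀⟩ := hbn.abs_sum_mul_le hα hη'0
  set B₁ : ℝ := max (W r₀) (1 + N₀ + α 0 * G) with hB₁
  -- The round `m` is the one after the last visit to the ball of radius `N₀`, or `r₀` if there was
  -- none since `r₀`.
  have hind : ∀ R, r₀ ≤ R → ∃ m, r₀ ≤ m ∧ m ≤ R ∧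
      W R ≤ B₁ + ∑ r ∈ Finset.Ico m R, α r * (-(δ / 4) + b r) := by
    intro R hR
    induction R, hR using Nat.le_induction with
    | base => exact ⟨r₀, le_rfl, le_rfl, by simp [hB₁]⟩
    | succ R hR ih =>
      rcases le_or_gt N₀ ‖ν R‖ with hc | hc
      · obtain ⟨m, h1, h2, h3⟩ := ih
        refine ⟨m, h1, h2.trans (Nat.le_succ R), ?_⟩
        rw [Finset.sum_Ico_succ_top h2]
        linarith [hdrift R hc]
      · refine ⟨R + 1, hR.trans (Nat.le_succ R), le_rfl, ?_⟩
        simp only [Finset.Ico_self, Finset.sum_empty, add_zero]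
        refine le_trans ?_ (le_max_right _ _)
        have h1 := abs_softNorm_sub_le one_pos (ν (R + 1)) (ν R)
        have h2 := hN.norm_sub_succ_le R
        have h3 := softNorm_le one_pos (ν R)
        have h4 : α R * G ≤ α 0 * G :=
          mul_le_mul_of_nonneg_right (hα.antitone (Nat.zero_le R))
            ((norm_nonneg _).trans (hN.norm_le 0))
        have h5 := (abs_le.1 h1).2
        simp only [hW]
        linarith
  have hB₁0 : 0 ≤ B₁ := (hW0 r₀).trans (le_max_left _ _)
  refine ⟨B₁ + ∑ r ∈ Finset.range r₀, W r, fun R => (norm_le_softNorm (H := 1) _).trans ?_⟩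
  have hsum0 : 0 ≤ ∑ r ∈ Finset.range r₀, W r := Finset.sum_nonneg fun r _ => hW0 r
  have hR0 : 0 ≤ ((R : ℝ) + 1) * α R := mul_nonneg (by positivity) (hα.pos R).le
  rcases lt_or_ge R r₀ with hlt | hge
  · have : W R ≤ ∑ r ∈ Finset.range r₀, W r :=
      Finset.single_le_sum (fun r _ => hW0 r) (Finset.mem_range.2 hlt)
    have h5 : 0 ≤ η * (((R : ℝ) + 1) * α R) := mul_nonneg hη.le hR0
    simp only [hW] at this ⊢
    linarith
  · obtain ⟨m, h1, h2, h3⟩ := hind R hge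
    have h4 := (abs_le.1 (hr₀ m R h1 h2)).2
    have hs : 0 ≤ ∑ r ∈ Finset.Ico m R, α r := Finset.sum_nonneg fun r _ => (hα.pos r).le
    have e : ∑ r ∈ Finset.Ico m R, α r * (-(δ / 4) + b r) =
        -(δ / 4) * ∑ r ∈ Finset.Ico m R, α r + ∑ r ∈ Finset.Ico m R, α r * b r := by
      rw [Finset.mul_sum, ← Finset.sum_add_distrib]
      exact Finset.sum_congr rfl fun r _ => by ring
    have h5 : η' * ∑ r ∈ Finset.Ico m R, α r ≤ δ / 4 * ∑ r ∈ Finset.Ico m R, α r :=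
      mul_le_mul_of_nonneg_right (min_le_left _ _) hs
    have h6 : η' * (2 * (((R : ℝ) + 1) * α R)) ≤ η / 2 * (2 * (((R : ℝ) + 1) * α R)) :=
      mul_le_mul_of_nonneg_right (min_le_right _ _) (by positivity)
    simp only [hW] at h3 hsum0 ⊢
    rw [e] at h3
    linarith

lemma flat_of_tendsto_atTop (hN : NoisySubgradient α z K D h ν g ε G Lip δ C)
    (htop : Tendsto (fun r : ℕ => ((r : ℝ) + 1) * α r) atTop atTop) {U : E → ℝ} {LU : ℝ}
    (hU : ∀ u v, |U u - U v| ≤ LU * ‖u - v‖) :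
    CesaroNull fun r => (U (ν r) - U (ν (r + 1))) / α r := by
  have hmain : Tendsto (fun r : ℕ => (U (ν r) - U 0) / (((r : ℝ) + 1) * α r)) atTop (𝓝 0) := by
    rw [Metric.tendsto_nhds]
    intro κ hκ
    obtain ⟨B, hB⟩ := hN.exists_norm_le (η := κ / (2 * (|LU| + 1))) (by positivity)
    filter_upwards [htop.eventually_gt_atTop (2 * (|LU| + 1) * |B| / κ), htop.eventually_gt_atTop 0]
      with R h1 h2
    rw [Real.dist_eq, sub_zero, abs_div, abs_of_pos h2, div_lt_iff₀ h2]
    have h3 := hU (ν R) 0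
    rw [sub_zero] at h3
    set t : ℝ := ((R : ℝ) + 1) * α R with ht
    rw [div_lt_iff₀ hκ] at h1
    have h4 : LU * ‖ν R‖ ≤ (|LU| + 1) * (|B| + κ / (2 * (|LU| + 1)) * t) :=
      mul_le_mul (by linarith [le_abs_self LU]) ((hB R).trans (by linarith [le_abs_self B]))
        (norm_nonneg _) (by positivity)
    have e : (|LU| + 1) * (|B| + κ / (2 * (|LU| + 1)) * t) = (|LU| + 1) * |B| + κ * t / 2 := by
      field_simp
    rw [e] at h4
    linarith
  refine (flat_of_tendsto_div hN.stepSize hmain).congr fun r => ?_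
  rw [sub_sub_sub_cancel_right]

end NoisySubgradient

end Subgradient

/-! ### Step sizes of order `1 / r`, and flatness in general. -/

section HarmonicSteps

variable {E P : Type*} [NormedAddCommGroup E] [InnerProductSpace ℝ E] [Fintype P]

/-- Monotonicity of `(r + 1) * α r` gives `α r ≥ α 0 / (r + 1)`, so the harmonic series is a lower
bound. -/
lemma IsStepSize.tendsto_sum_Ico {α : ℕ → ℝ} (hα : IsStepSize α) (m : ℕ) :
    Tendsto (fun R => ∑ r ∈ Finset.Ico m R, α r) atTop atTop := by
  have h1 : ¬ Summable α := by
    intro hs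
    have h2 : Summable fun r : ℕ => α 0 * (1 / ((r : ℝ) + 1)) := by
      refine Summable.of_nonneg_of_le (fun r => ?_) (fun r => ?_) hs
      · exact mul_nonneg (hα.pos 0).le (by positivity)
      · have := hα.mul_mono (Nat.zero_le r)
        simp only [Nat.cast_zero, zero_add, one_mul] at this
        rw [mul_one_div, div_le_iff₀ (by positivity)]
        linarith
    have h3 := (summable_mul_left_iff (hα.pos 0).ne').1 h2
    have h4 : Summable fun n : ℕ => 1 / (n : ℝ) := by
      rw [← summable_nat_add_iff 1]
      simpa using h3
    exact Real.not_summable_one_div_natCast h4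
  have h2 := (not_summable_iff_tendsto_nat_atTop_of_nonneg fun r => (hα.pos r).le).1 h1
  have h3 := tendsto_atTop_add_const_right atTop (-∑ r ∈ Finset.range m, α r) h2
  refine h3.congr' ?_
  filter_upwards [eventually_ge_atTop m] with R hR
  rw [Finset.sum_Ico_eq_sub _ hR]
  ring

namespace NoisySubgradient

variable {α : ℕ → ℝ} {z : P → ℕ → ℝ} {K : Set E} {D : E → ℝ} {h : P → E → ℝ}
  {ν g : ℕ → E} {ε : ℕ → ℝ} {G Lip δ C : ℝ}

/-- The distance to a comparison point decreases up to small errors. -/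
lemma exists_norm_sq_le (hN : NoisySubgradient α z K D h ν g ε G Lip δ C) {B : ℝ}
    (hB : ∀ r, ‖ν r‖ ≤ B) {c : ℝ} (hc : ∀ r : ℕ, ((r : ℝ) + 1) * α r ≤ c) {θ : E} (hθ : θ ∈ K)
    {η : ℝ} (hη : 0 < η) : ∃ r₀ : ℕ, ∀ m R, r₀ ≤ m → m ≤ R →
      ‖ν R - θ‖ ^ 2 ≤ ‖ν m - θ‖ ^ 2 - 2 * ∑ r ∈ Finset.Ico m R, α r * (D (ν r) - D θ) +
        η * (1 + ∑ r ∈ Finset.Ico m R, α r) := by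
  have hα := hN.stepSize
  set b : ℕ → ℝ := fun r =>
    ε r + α r * (G ^ 2 / 2) - ∑ p, z p r * (h p (ν r) - h p θ) with hb
  have hbn : CesaroNull b := by
    refine CesaroNull.sub (cesaroNull_of_tendsto_zero ?_) ?_
    · simpa using hN.error.add (hα.tendsto_zero.mul_const (G ^ 2 / 2))
    · refine CesaroNull.sum _ fun p _ => ?_
      exact (hN.blockNull p).cesaroNull_mul_lipschitz (hN.abs_le_one p) hB
        hN.tendsto_norm_sub_succ (f := fun v => h p v - h p θ) (Lip := Lip)
        fun u v => by
          rw [sub_sub_sub_cancel_right]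
          exact hN.lipschitz p u v
  have hc0 : 0 < c := lt_of_lt_of_le (mul_pos (by positivity) (hα.pos 0)) (hc 0)
  have hstep : ∀ r, ‖ν (r + 1) - θ‖ ^ 2 ≤
      ‖ν r - θ‖ ^ 2 - 2 * (α r * (D (ν r) - D θ)) + 2 * (α r * b r) := by
    intro r
    have h1 := hN.norm_sq_succ_le r hθ
    have h2 := mul_le_mul_of_nonneg_left (hN.subgradient r θ hθ) (hα.pos r).le
    simp only [hb]
    nlinarith
  set η' : ℝ := min (η / 2) (η / (4 * c)) with hη'
  have hη'0 : 0 < η' := lt_min (by positivity) (by positivity)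
  obtain ⟨r₀, hr₀⟩ := hbn.abs_sum_mul_le hα hη'0
  refine ⟨r₀, fun m R hm hmR => ?_⟩
  have hsum : ∀ R, m ≤ R → ‖ν R - θ‖ ^ 2 ≤
      ‖ν m - θ‖ ^ 2 - 2 * ∑ r ∈ Finset.Ico m R, α r * (D (ν r) - D θ) +
        2 * ∑ r ∈ Finset.Ico m R, α r * b r := by
    intro R hR
    induction R, hR using Nat.le_induction with
    | base => simp
    | succ R hR ih =>
      rw [Finset.sum_Ico_succ_top hR, Finset.sum_Ico_succ_top hR]
      linarith [hstep R]
  have h1 := hsum R hmR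
  have h2 := (abs_le.1 (hr₀ m R hm hmR)).2
  have hs : 0 ≤ ∑ r ∈ Finset.Ico m R, α r := Finset.sum_nonneg fun r _ => (hα.pos r).le
  have h3 : η' * ∑ r ∈ Finset.Ico m R, α r ≤ η / 2 * ∑ r ∈ Finset.Ico m R, α r :=
    mul_le_mul_of_nonneg_right (min_le_left _ _) hs
  have h4 : η' * (2 * (((R : ℝ) + 1) * α R)) ≤ η / (4 * c) * (2 * c) :=
    mul_le_mul (min_le_right _ _) (by linarith [hc R])
      (mul_nonneg zero_le_two (mul_nonneg (by positivity) (hα.pos R).le)) (by positivity)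
  have e : η / (4 * c) * (2 * c) = η / 2 := by
    field_simp
    norm_num
  linarith

/-- Bounded points at which `D` is almost minimal are close to finitely many minimizers. -/
lemma exists_finite_net [ProperSpace E] (hN : NoisySubgradient α z K D h ν g ε G Lip δ C)
    (B : ℝ) {κ : ℝ} (hκ : 0 < κ) : ∃ θ₀ ∈ K, (∀ v ∈ K, D θ₀ ≤ D v) ∧
      ∃ t : Finset E, (∀ θ ∈ t, θ ∈ K ∧ D θ = D θ₀) ∧ ∃ τ > 0,
        ∀ v ∈ K, ‖v‖ ≤ B → D v < D θ₀ + τ → ∃ θ ∈ t, ‖v - θ‖ < κ := by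
  have hδ := hN.pos
  have hbd : ∀ v ∈ K, D v ≤ D 0 → ‖v‖ ≤ (D 0 + C) / δ := by
    intro v hv hD
    rw [le_div_iff₀ hδ]
    linarith [hN.coercive v hv]
  have hcpt : ∀ b, IsCompact (K ∩ Metric.closedBall 0 b) := fun b =>
    (isCompact_closedBall 0 b).inter_left hN.isClosed
  have h0 : (0 : E) ∈ K ∩ Metric.closedBall 0 ((D 0 + C) / δ) :=
    ⟨hN.zero_mem, by simpa using (norm_nonneg _).trans (hbd 0 hN.zero_mem le_rfl)⟩
  obtain ⟨θ₀, hθ₀, hmin⟩ := (hcpt _).exists_isMinOn ⟨0, h0⟩ hN.continuous.continuousOn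
  have hmin' : ∀ v ∈ K, D θ₀ ≤ D v := by
    intro v hv
    rcases le_or_gt (D v) (D 0) with h1 | h1
    · exact hmin ⟨hv, by simpa using hbd v hv h1⟩
    · exact (hmin h0).trans h1.le
  refine ⟨θ₀, hθ₀.1, hmin', ?_⟩
  set A : Set E := (K ∩ Metric.closedBall 0 ((D 0 + C) / δ)) ∩ {v | D v ≤ D θ₀} with hA
  have hAc : IsCompact A := (hcpt _).inter_right (isClosed_le hN.continuous continuous_const)
  obtain ⟨t, htA, htf, htcov⟩ := 
    Metric.finite_approx_of_totallyBounded hAc.totallyBounded κ hκ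
  refine ⟨htf.toFinset, fun θ hθ => ?_, ?_⟩
  · have := htA (htf.mem_toFinset.1 hθ)
    exact ⟨this.1.1, le_antisymm this.2 (hmin' θ this.1.1)⟩
  -- On this compact set, which contains no minimizer, `D` exceeds its minimum by a positive gap;
  -- that gap is `τ`.
  set Q : Set E := (K ∩ Metric.closedBall 0 B) ∩ {v | ∀ θ ∈ t, κ ≤ ‖v - θ‖} with hQ
  have hQc : IsCompact Q := by
    refine (hcpt _).inter_right ?_
    simp only [ofPred_forall]
    exact isClosed_iInter fun θ => isClosed_iInter fun _ =>
      isClosed_le continuous_const (continuous_id.sub continuous_const).norm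
  have key : ∀ τ : ℝ, (∀ v ∈ Q, D θ₀ + τ ≤ D v) →
      ∀ v ∈ K, ‖v‖ ≤ B → D v < D θ₀ + τ → ∃ θ ∈ htf.toFinset, ‖v - θ‖ < κ := by
    intro τ hτ v hv hvB hD
    by_contra! hcon
    refine absurd (hτ v ⟨⟨hv, by simpa using hvB⟩, fun θ hθ => ?_⟩) (not_le.2 hD)
    exact hcon θ (htf.mem_toFinset.2 hθ)
  rcases Q.eq_empty_or_nonempty with hempty | hne
  · exact ⟨1, one_pos, key 1 (by simp [hempty])⟩
  · obtain ⟨v₀, hv₀, hv₀min⟩ := hQc.exists_isMinOn hne hN.continuous.continuousOn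
    refine ⟨D v₀ - D θ₀, ?_, key _ fun v hv => ?_⟩
    · by_contra! hle
      have hle' : D v₀ ≤ D θ₀ := by linarith
      have hv₀A : v₀ ∈ A :=
        ⟨⟨hv₀.1.1, by simpa using hbd v₀ hv₀.1.1 (hle'.trans (hmin' 0 hN.zero_mem))⟩, hle'⟩
      obtain ⟨θ, hθ, hd⟩ := mem_iUnion₂.1 (htcov hv₀A)
      rw [Metric.mem_ball, dist_eq_norm] at hd
      exact absurd (hv₀.2 θ hθ) (not_le.2 hd)
    · have := hv₀min hv
      simp only [mem_ofPred_eq] at this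
      linarith

/-- If the step sizes decay like `1 / r`, then the iterates hardly move within stretches of rounds
of bounded total step size. -/
lemma exists_norm_sub_le [ProperSpace E] (hN : NoisySubgradient α z K D h ν g ε G Lip δ C) {B : ℝ}
    (hB : ∀ r, ‖ν r‖ ≤ B) {c : ℝ} (hc : ∀ r : ℕ, ((r : ℝ) + 1) * α r ≤ c) {κ : ℝ} (hκ : 0 < κ)
    {T : ℝ} (hT : 0 ≤ T) : ∃ r₀ : ℕ, ∀ m R, r₀ ≤ m → m ≤ R → ∑ r ∈ Finset.Ico m R, α r ≤ T →
      ‖ν m - ν R‖ ≤ 4 * κ := by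
  have hα := hN.stepSize
  obtain ⟨θ₀, hθ₀K, hmin, t, ht, τ, hτ, hnear⟩ := hN.exists_finite_net B hκ
  set F : ℝ := (B + ‖θ₀‖) ^ 2 with hF
  -- This is the largest total step size the iterates can spend with `D` at least `τ` above the
  -- minimum, since the squared distance to `θ₀` starts at most at `F` and stays nonnegative. `T₂`
  -- adds the one step leaving a near-optimal round (at most `α 0`) and the stretch `T`.
  set T₁ : ℝ := (F + τ) / τ with hT₁
  have hT₁0 : 0 ≤ T₁ := by positivity
  set T₂ : ℝ := α 0 + T₁ + T with hT₂
  have hT₂0 : 0 ≤ T₂ := by have := (hα.pos 0).le; positivity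
  obtain ⟨q, hq⟩ := hN.exists_norm_sq_le hB hc hθ₀K hτ
  have hη : 0 < κ ^ 2 / (1 + T₂) := by positivity
  have hfej : ∃ q' : ℕ, ∀ θ ∈ t, ∀ m R, q' ≤ m → m ≤ R →
      ‖ν R - θ‖ ^ 2 ≤ ‖ν m - θ‖ ^ 2 - 2 * ∑ r ∈ Finset.Ico m R, α r * (D (ν r) - D θ) +
        κ ^ 2 / (1 + T₂) * (1 + ∑ r ∈ Finset.Ico m R, α r) := by
    -- The threshold depends on the comparison point; finiteness of the net makes it uniform.
    choose! f hf using fun θ (hθ : θ ∈ t) => hN.exists_norm_sq_le hB hc (ht θ hθ).1 hη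
    exact ⟨t.sup f, fun θ hθ m R hm => hf θ hθ m R ((Finset.le_sup hθ).trans hm)⟩
  obtain ⟨q', hq'⟩ := hfej
  set s₀ := max q q' with hs₀
  obtain ⟨r₀, hr₀⟩ := eventually_atTop.1 ((hα.tendsto_sum_Ico s₀).eventually_gt_atTop T₁)
  have hfar : ∀ j m, s₀ ≤ j → j ≤ m → (∀ r, j ≤ r → r < m → D θ₀ + τ ≤ D (ν r)) →
      ∑ r ∈ Finset.Ico j m, α r ≤ T₁ := by
    intro j m hj hjm hD
    have h1 := hq j m ((le_max_left _ _).trans hj) hjm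
    have h2 : τ * ∑ r ∈ Finset.Ico j m, α r ≤ ∑ r ∈ Finset.Ico j m, α r * (D (ν r) - D θ₀) := by
      rw [Finset.mul_sum]
      refine Finset.sum_le_sum fun r hr => ?_
      obtain ⟨hr1, hr2⟩ := Finset.mem_Ico.1 hr
      rw [mul_comm]
      exact mul_le_mul_of_nonneg_left (by linarith [hD r hr1 hr2]) (hα.pos r).le
    have h3 : ‖ν j - θ₀‖ ^ 2 ≤ F :=
      pow_le_pow_left₀ (norm_nonneg _) ((norm_sub_le _ _).trans (by linarith [hB j])) 2
    rw [hT₁, le_div_iff₀ hτ]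
    nlinarith [sq_nonneg ‖ν m - θ₀‖]
  refine ⟨max s₀ r₀, fun m R hm hmR hsum => ?_⟩
  have hms : s₀ ≤ m := (le_max_left _ _).trans hm
  have hmr : r₀ ≤ m := (le_max_right _ _).trans hm
  classical
  set J := (Finset.Ico s₀ m).filter fun j => D (ν j) < D θ₀ + τ with hJ
  have hJne : J.Nonempty := by
    by_contra hne
    rw [Finset.not_nonempty_iff_eq_empty, Finset.filter_eq_empty_iff] at hne
    refine absurd (hfar s₀ m le_rfl hms fun r h1 h2 => ?_) (not_le.2 (hr₀ m hmr))
    exact not_lt.1 (hne (Finset.mem_Ico.2 ⟨h1, h2⟩))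
  -- Round `j` is the last near-optimal one before `m`; the total step size from `j` to `m` is at
  -- most `α 0 + T₁`.
  set j := J.max' hJne with hj
  obtain ⟨hjI, hjD⟩ := Finset.mem_filter.1 (J.max'_mem hJne)
  obtain ⟨hj1, hj2⟩ := Finset.mem_Ico.1 hjI
  rw [← hj] at hj1 hj2 hjD
  have hjm : ∑ r ∈ Finset.Ico j m, α r ≤ α 0 + T₁ := by
    rw [Finset.sum_eq_sum_Ico_succ_bot hj2]
    refine add_le_add (hα.antitone (Nat.zero_le j)) (hfar (j + 1) m (hj1.trans (Nat.le_succ j)) hj2 ?_)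
    intro r h1 h2
    by_contra! hlt
    have := J.le_max' r (Finset.mem_filter.2 ⟨Finset.mem_Ico.2 ⟨by omega, h2⟩, hlt⟩)
    omega
  obtain ⟨θ, hθt, hθ⟩ := hnear (ν j) (hN.mem j) (hB j) hjD
  -- As `θ` minimizes `D`, the drift term can only help. The squared distance to `θ` starts below `κ
  -- ^ 2` and gains at most another `κ ^ 2` within total step size `T₂`.
  have hclose : ∀ k, j ≤ k → ∑ r ∈ Finset.Ico j k, α r ≤ T₂ → ‖ν k - θ‖ ≤ 2 * κ := by
    intro k hjk hk
    have h1 := hq' θ hθt j k ((le_max_right _ _).trans hj1) hjk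
    have h2 : 0 ≤ ∑ r ∈ Finset.Ico j k, α r * (D (ν r) - D θ) := by
      refine Finset.sum_nonneg fun r _ => mul_nonneg (hα.pos r).le ?_
      rw [(ht θ hθt).2, sub_nonneg]
      exact hmin _ (hN.mem r)
    have h3 : κ ^ 2 / (1 + T₂) * (1 + ∑ r ∈ Finset.Ico j k, α r) ≤ κ ^ 2 / (1 + T₂) * (1 + T₂) :=
      mul_le_mul_of_nonneg_left (by linarith) hη.le
    rw [div_mul_cancel₀ _ (by positivity)] at h3
    have h4 : ‖ν j - θ‖ ^ 2 ≤ κ ^ 2 := pow_le_pow_left₀ (norm_nonneg _) hθ.le 2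
    refine le_of_sq_le_sq (by nlinarith) (by positivity)
  have h1 := hclose m hj2.le (by linarith)
  have h2 := hclose R (hj2.le.trans hmR) (by
    rw [← Finset.sum_Ico_consecutive _ hj2.le hmR]
    linarith)
  have h3 := norm_sub_le_norm_sub_add_norm_sub (ν m) θ (ν R)
  rw [norm_sub_rev θ] at h3
  linarith

lemma flat_of_tendsto_nhds [ProperSpace E] (hN : NoisySubgradient α z K D h ν g ε G Lip δ C)
    {c : ℝ} (hlim : Tendsto (fun r : ℕ => ((r : ℝ) + 1) * α r) atTop (𝓝 c)) {U : E → ℝ} {LU : ℝ}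
    (hU : ∀ u v, |U u - U v| ≤ LU * ‖u - v‖) :
    CesaroNull fun r => (U (ν r) - U (ν (r + 1))) / α r := by
  have hα := hN.stepSize
  have hc : ∀ r : ℕ, ((r : ℝ) + 1) * α r ≤ c := fun r => hα.mul_mono.ge_of_tendsto hlim r
  have hc0 : 0 < c := lt_of_lt_of_le (mul_pos (by positivity) (hα.pos 0)) (hc 0)
  obtain ⟨B, hB⟩ : ∃ B, ∀ r, ‖ν r‖ ≤ B := by
    obtain ⟨B, hB⟩ := hN.exists_norm_le one_pos
    exact ⟨B + 1 * c, fun r => (hB r).trans (by linarith [hc r])⟩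
  have hB0 : 0 ≤ B := (norm_nonneg _).trans (hB 0)
  refine flat_of_average_sub (U := fun r => U (ν r)) (G := |LU| * G) hc0 hα hlim (fun r => ?_) ?_
  · refine (hU _ _).trans ?_
    rw [norm_sub_rev]
    calc LU * ‖ν (r + 1) - ν r‖ ≤ |LU| * (α r * G) :=
          mul_le_mul (le_abs_self _) (hN.norm_sub_succ_le r) (norm_nonneg _) (abs_nonneg _)
      _ = _ := by ring
  have hav : Tendsto (fun R : ℕ => (∑ r ∈ Finset.range R, ‖ν r - ν R‖) / R) atTop (𝓝 0) := by
    rw [Metric.tendsto_nhds]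
    intro κ hκ
    -- The first `R / q` rounds contribute at most `2 * B` each, hence less than `κ / 4` to the
    -- average. Later rounds are within total step size `c * q` of round `R`, where the iterates
    -- hardly move.
    obtain ⟨q, hq⟩ := exists_nat_gt (8 * B / κ)
    have hq0 : 0 < (q : ℝ) := lt_of_le_of_lt (by positivity) hq
    have hq0' : 0 < q := by exact_mod_cast hq0
    obtain ⟨r₀, hr₀⟩ := hN.exists_norm_sub_le hB hc (κ := κ / 16) (by positivity)
      (T := c * q) (by positivity)
    filter_upwards [eventually_gt_atTop (q * (r₀ + 1))] with R hR
    have hRpos : 0 < R := lt_of_le_of_lt (Nat.zero_le _) hR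
    have hRr : (0 : ℝ) < R := by exact_mod_cast hRpos
    have hnn : 0 ≤ ∑ r ∈ Finset.range R, ‖ν r - ν R‖ := Finset.sum_nonneg fun _ _ => norm_nonneg _
    rw [Real.dist_eq, sub_zero, abs_of_nonneg (by positivity), div_lt_iff₀ hRr]
    have hterm : ∀ r ∈ Finset.range R,
        ‖ν r - ν R‖ ≤ κ / 4 + if r < R / q then 2 * B else 0 := by
      intro r hr
      split_ifs with hlt
      · linarith [norm_sub_le (ν r) (ν R), hB r, hB R]
      · have h1 : R < q * (r + 1) := by
          rw [mul_comm]
          exact (Nat.div_lt_iff_lt_mul hq0').1 (by omega)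
        have h2 : r₀ ≤ r := by
          have := lt_of_mul_lt_mul_left (hR.trans h1) (Nat.zero_le q)
          omega
        have h3 : ∑ k ∈ Finset.Ico r R, α k ≤ c * q := by
          have h4 : ∀ k ∈ Finset.Ico r R, α k ≤ c / ((r : ℝ) + 1) := by
            intro k hk
            rw [le_div_iff₀ (by positivity), mul_comm]
            refine le_trans ?_ (hc k)
            have : (r : ℝ) ≤ k := by exact_mod_cast (Finset.mem_Ico.1 hk).1
            exact mul_le_mul_of_nonneg_right (by linarith) (hα.pos k).le
          refine (Finset.sum_le_sum h4).trans ?_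
          rw [Finset.sum_const, nsmul_eq_mul, Nat.card_Ico, mul_div_assoc', div_le_iff₀ (by positivity)]
          have h5 : ((R - r : ℕ) : ℝ) ≤ R := by exact_mod_cast Nat.sub_le R r
          have h6 : (R : ℝ) ≤ q * (r + 1) := by exact_mod_cast h1.le
          nlinarith
        have := hr₀ r R h2 (Finset.mem_range.1 hr).le h3
        linarith
    have h7 : ∑ r ∈ Finset.range R, (if r < R / q then 2 * B else 0) ≤ (R / q : ℝ) * (2 * B) := by
      rw [← Finset.sum_filter, Finset.sum_const, nsmul_eq_mul]
      refine mul_le_mul_of_nonneg_right ?_ (by positivity)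
      refine le_trans ?_ (Nat.cast_div_le (m := R) (n := q))
      rw [Nat.cast_le]
      calc _ ≤ (Finset.range (R / q)).card := Finset.card_le_card fun r hr => by
            simpa using (Finset.mem_filter.1 hr).2
        _ = _ := Finset.card_range _
    have h8 := Finset.sum_le_sum hterm
    rw [Finset.sum_add_distrib, Finset.sum_const, Finset.card_range, nsmul_eq_mul] at h8
    have h9 : (R / q : ℝ) * (2 * B) ≤ R * (κ / 4) := by
      rw [div_mul_eq_mul_div, div_le_iff₀ hq0]
      rw [div_lt_iff₀ hκ] at hq
      nlinarith
    nlinarith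
  have hav' := hav.const_mul |LU|
  rw [mul_zero] at hav'
  refine squeeze_zero_norm (fun R => ?_) hav'
  rw [Real.norm_eq_abs, abs_div, Nat.abs_cast, mul_div_assoc', Finset.mul_sum]
  refine div_le_div_of_nonneg_right ((Finset.abs_sum_le_sum_abs _ _).trans ?_) (by positivity)
  exact Finset.sum_le_sum fun r _ =>
    (hU _ _).trans (mul_le_mul_of_nonneg_right (le_abs_self _) (norm_nonneg _))

theorem flat [ProperSpace E] (hN : NoisySubgradient α z K D h ν g ε G Lip δ C) {U : E → ℝ}
    {LU : ℝ} (hU : ∀ u v, |U u - U v| ≤ LU * ‖u - v‖) :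
    CesaroNull fun r => (U (ν r) - U (ν (r + 1))) / α r := by
  rcases tendsto_atTop_of_monotone hN.stepSize.mul_mono with h | ⟨c, h⟩
  · exact hN.flat_of_tendsto_atTop h hU
  · exact hN.flat_of_tendsto_nhds h hU

/-- The radially weighted products of subgradients and iterates are negligible in the mean. -/
lemma exists_cesaroNull_inner_le [ProperSpace E]
    (hN : NoisySubgradient α z K D h ν g ε G Lip δ C) {H : ℝ} (hH : 0 < H) :
    ∃ b : ℕ → ℝ, CesaroNull b ∧ ∀ r, radialWeight H (ν r) * inner ℝ (g r) (ν r) ≤ b r := by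
  refine ⟨_, CesaroNull.add (hN.flat (U := fun v => H * softNorm H v) (LU := H) fun u v => ?_)
    (cesaroNull_of_tendsto_zero ?_), hN.softNorm_succ_le hH⟩
  · rw [← mul_sub, abs_mul, abs_of_pos hH]
    exact mul_le_mul_of_nonneg_left (abs_softNorm_sub_le hH u v) hH.le
  · simpa using hN.stepSize.tendsto_zero.mul_const (G ^ 2 / 2)

/-- The iterates are rarely far from the origin. -/
lemma exists_one_sub_radialWeight_le [ProperSpace E]
    (hN : NoisySubgradient α z K D h ν g ε G Lip δ C) {H : ℝ} (hH : 0 < H) :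
    ∃ b : ℕ → ℝ, CesaroNull b ∧
      ∀ r, 1 - radialWeight H (ν r) ≤ (D 0 + C) / (δ * H) + b r := by
  have hδ := hN.pos
  obtain ⟨b, hb, hle⟩ := hN.exists_cesaroNull_inner_le hH
  refine ⟨_, (hb.sub (hN.cesaroNull_noise hH hN.lipschitz hN.homogeneous)).const_mul (1 / (δ * H)),
    fun r => ?_⟩
  have h1 := hN.mul_coercive_le hH r
  have h2 := hle r
  have h0 : 0 ≤ D 0 + C := by
    have := hN.coercive 0 hN.zero_mem
    rw [norm_zero] at this
    linarith
  have h3 : radialWeight H (ν r) * (D 0 + C) ≤ D 0 + C :=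
    mul_le_of_le_one_left h0 (radialWeight_le_one hH _)
  refine (one_sub_radialWeight_le hH (ν r)).trans ?_
  rw [one_div_mul_eq_div, ← add_div, le_div_iff₀ (by positivity), div_mul_eq_mul_div,
    div_le_iff₀ hH]
  nlinarith

end NoisySubgradient

end HarmonicSteps

/-! ### Utilities, their conjugates and bounded responses. -/

section Utilities

/-- The points of `[0, ∞)` at which a utility is finite. -/
def effDomain (V : ℝ → EReal) : Set ℝ := {y | 0 ≤ y ∧ V y ≠ ⊥}

namespace IsUtility

variable {V : ℝ → EReal}

lemma coe_toReal (hV : IsUtility V) {y : ℝ} (hy : y ∈ effDomain V) :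
    ((V y).toReal : EReal) = V y := EReal.coe_toReal (hV.ne_top y hy.1) hy.2

lemma mem_effDomain (hV : IsUtility V) {y : ℝ} (hy : 0 < y) : y ∈ effDomain V :=
  ⟨hy.le, hV.ne_bot y hy⟩

lemma toReal_mono (hV : IsUtility V) {y w : ℝ} (hy : y ∈ effDomain V) (h : y ≤ w) :
    (V y).toReal ≤ (V w).toReal :=
  EReal.toReal_le_toReal (hV.mono hy.1 (hy.1.trans h) h) hy.2 (hV.ne_top w (hy.1.trans h))

lemma concaveOn (hV : IsUtility V) : ConcaveOn ℝ (effDomain V) fun y => (V y).toReal := by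
  have key : ∀ ⦃u⦄, u ∈ effDomain V → ∀ ⦃w⦄, w ∈ effDomain V → ∀ ⦃a b : ℝ⦄, 0 ≤ a → 0 ≤ b →
      a + b = 1 → ((a * (V u).toReal + b * (V w).toReal : ℝ) : EReal) ≤ V (a * u + b * w) := by
    intro u hu w hw a b ha hb hab
    have := hV.concave u w a b hu.1 hw.1 ha hb hab
    rwa [← hV.coe_toReal hu, ← hV.coe_toReal hw, ← EReal.coe_mul, ← EReal.coe_mul,
      ← EReal.coe_add] at this
  have hmem : ∀ ⦃u⦄, u ∈ effDomain V → ∀ ⦃w⦄, w ∈ effDomain V → ∀ ⦃a b : ℝ⦄, 0 ≤ a → 0 ≤ b →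
      a + b = 1 → a * u + b * w ∈ effDomain V := by
    intro u hu w hw a b ha hb hab
    refine ⟨add_nonneg (mul_nonneg ha hu.1) (mul_nonneg hb hw.1), fun hbot => ?_⟩
    have := key hu hw ha hb hab
    rw [hbot, le_bot_iff] at this
    exact EReal.coe_ne_bot _ this
  refine ⟨fun u hu w hw a b ha hb hab => hmem hu hw ha hb hab,
    fun u hu w hw a b ha hb hab => ?_⟩
  have h1 := key hu hw ha hb hab
  rw [smul_eq_mul, smul_eq_mul, smul_eq_mul, smul_eq_mul]
  rw [← hV.coe_toReal (hmem hu hw ha hb hab)] at h1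
  exact_mod_cast h1

/-- Maximizers of `V y - t y` in terms of real numbers. -/
lemma maximizer (hV : IsUtility V) {t y : ℝ} (hy : 0 ≤ y)
    (hmax : ∀ u, 0 ≤ u → V u - ((t * u : ℝ) : EReal) ≤ V y - ((t * y : ℝ) : EReal)) :
    y ∈ effDomain V ∧ ∀ u ∈ effDomain V, (V u).toReal - t * u ≤ (V y).toReal - t * y := by
  have hmem : y ∈ effDomain V := by
    refine ⟨hy, fun hbot => ?_⟩
    have h1 := hmax 1 zero_le_one
    rw [hbot, EReal.bot_sub, ← hV.coe_toReal (hV.mem_effDomain one_pos), ← EReal.coe_sub,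
      le_bot_iff] at h1
    exact EReal.coe_ne_bot _ h1
  refine ⟨hmem, fun u hu => ?_⟩
  have h1 := hmax u hu.1
  rw [← hV.coe_toReal hu, ← hV.coe_toReal hmem, ← EReal.coe_sub, ← EReal.coe_sub] at h1
  exact_mod_cast h1

end IsUtility

/-- The conjugate `max {V y - t y : 0 ≤ y ≤ b}`. -/
def conjugate (V : ℝ → EReal) (b t : ℝ) : ℝ :=
  ⨆ y : {y // y ∈ effDomain V ∧ y ≤ b}, ((V y).toReal - t * y)

namespace IsUtility

variable {V : ℝ → EReal} {b : ℝ}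

lemma bddAbove_conjugate (hV : IsUtility V) (t : ℝ) :
    BddAbove (range fun y : {y // y ∈ effDomain V ∧ y ≤ b} => (V y).toReal - t * y) := by
  refine ⟨(V b).toReal + |t| * b, ?_⟩
  rintro _ ⟨⟨y, hy, hyb⟩, rfl⟩
  have h1 := hV.toReal_mono hy hyb
  have h2 : -t * y ≤ |t| * b := mul_le_mul (neg_le_abs t) hyb hy.1 (abs_nonneg t)
  simp only
  linarith

lemma le_conjugate (hV : IsUtility V) (t : ℝ) {y : ℝ} (hy : y ∈ effDomain V) (hyb : y ≤ b) :
    (V y).toReal - t * y ≤ conjugate V b t :=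
  le_ciSup (hV.bddAbove_conjugate t) ⟨y, hy, hyb⟩

/-- The cap `b` keeps the conjugate finite and Lipschitz even where the unrestricted supremum is
infinite, as for the logarithm at `t = 0`. It is harmless wherever an unrestricted maximizer lies
below it. -/
lemma conjugate_eq (hV : IsUtility V) {t y : ℝ} (hy : y ∈ effDomain V) (hyb : y ≤ b)
    (hmax : ∀ u ∈ effDomain V, (V u).toReal - t * u ≤ (V y).toReal - t * y) :
    conjugate V b t = (V y).toReal - t * y := by
  have : Nonempty {y // y ∈ effDomain V ∧ y ≤ b} := ⟨⟨y, hy, hyb⟩⟩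
  exact le_antisymm (ciSup_le fun u => hmax u u.2.1) (hV.le_conjugate t hy hyb)

lemma continuous_conjugate (hV : IsUtility V) (hb : 0 < b) : Continuous (conjugate V b) := by
  have : Nonempty {y // y ∈ effDomain V ∧ y ≤ b} := ⟨⟨b, hV.mem_effDomain hb, le_rfl⟩⟩
  have hle : ∀ s t, conjugate V b s ≤ conjugate V b t + b * |s - t| := by
    intro s t
    refine ciSup_le fun ⟨y, hy, hyb⟩ => ?_
    have h1 := hV.le_conjugate t hy hyb
    have h2 : -(s - t) * y ≤ |s - t| * b := mul_le_mul (neg_le_abs _) hyb hy.1 (abs_nonneg _)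
    simp only
    linarith
  refine (LipschitzWith.of_le_add_mul b.toNNReal fun s t => ?_).continuous
  rw [Real.coe_toNNReal b hb.le, Real.dist_eq]
  exact hle s t

end IsUtility

/-- The auxiliary variables of a run stay bounded: at new minima of the multiplier, the response
cannot exceed the bound on the arrivals. -/
lemma exists_response_le {α lam c : ℕ → ℝ} {Y : ℝ → ℝ} {x : ℝ} (hα0 : ∀ r, 0 < α r)
    (hα : Tendsto α atTop (𝓝 0)) (hc : ∀ r, c r ≤ x) (hY0 : ∀ r, 0 ≤ Y (lam r))
    (hY : ∀ r s, lam r < lam s → Y (lam s) ≤ Y (lam r))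
    (hlam : ∀ r, lam (r + 1) = max 0 (lam r - α r * (c r - Y (lam r)))) :
    ∃ B, ∀ r, Y (lam r) ≤ B := by
  by_cases hall : ∀ r, Y (lam r) ≤ x
  · exact ⟨x, hall⟩
  push Not at hall
  obtain ⟨r, hr⟩ := hall
  -- The response is nonincreasing in the multiplier, so a smallest multiplier has the largest
  -- response. Equal multipliers cause no trouble, because the response is a function of the
  -- multiplier.
  suffices hmin : ∃ k, ∀ s, lam k ≤ lam s by
    obtain ⟨k, hk⟩ := hmin
    refine ⟨Y (lam k), fun s => ?_⟩
    rcases (hk s).eq_or_lt with h | h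
    · rw [h]
    · exact hY k s h
  by_cases hr' : ∀ s, lam r ≤ lam s
  · exact ⟨r, hr'⟩
  push Not at hr'
  obtain ⟨r', hlt⟩ := hr'
  have hlim : Tendsto (fun s => α s * x) atTop (𝓝 0) := by simpa using hα.mul_const x
  obtain ⟨r₁, hr₁⟩ := eventually_atTop.1 (hlim.eventually_lt_const (sub_pos.2 hlt))
  obtain ⟨k, -, hk⟩ := Finset.exists_min_image (Finset.range (max r₁ r' + 1)) lam ⟨0, by simp⟩
  refine ⟨k, fun s => ?_⟩
  have hsmall : ∀ s, s ≤ max r₁ r' → lam k ≤ lam s := fun s hs =>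
    hk s (Finset.mem_range.2 (Nat.lt_succ_of_le hs))
  rcases le_total s (max r₁ r') with hs | hs
  · exact hsmall s hs
  induction s, hs using Nat.le_induction with
  | base => exact hsmall _ le_rfl
  | succ s hs ih =>
    rw [hlam]
    refine le_trans ?_ (le_max_right _ _)
    have hp := hα0 s
    -- At or below `lam r` the response exceeds `x`, hence the arrivals, and the multiplier
    -- increases. Above `lam r`, one step lowers it by at most `α s * x`, which is less than `lam r
    -- - lam r'`, so it stays above `lam r'`.
    rcases le_or_gt (lam s) (lam r) with hle | hgt
    · have hYs : Y (lam r) ≤ Y (lam s) := by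
        rcases hle.eq_or_lt with h | h
        · rw [h]
        · exact hY s r h
      nlinarith [hc s]
    · have h1 := hr₁ s ((le_max_left _ _).trans hs)
      have h2 := hsmall r' (le_max_right _ _)
      have h3 : α s * (c s - Y (lam s)) ≤ α s * x :=
        mul_le_mul_of_nonneg_left (by linarith [hc s, hY0 s]) hp.le
      linarith

end Utilities

/-! ### Selections and their support functions. -/

namespace TaskModel

variable {N L P : Type*} (M : TaskModel N L P)

lemma x_nonneg (p : P) (l : L) : 0 ≤ M.x p l := Nat.cast_nonneg _

lemma x_le [Fintype N] (p : P) (l : L) : M.x p l ≤ Fintype.card N := by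
  rw [x, ← Nat.card_eq_fintype_card]
  exact_mod_cast Finite.card_subtype_le _

lemma mem_Icc_of_mem_selections [Fintype L] {p : P} {q : L → ℝ} (hq : q ∈ M.Selections p) (l : L) :
    q l ∈ Icc (0 : ℝ) 1 := by
  rcases hq.1 l with h | h <;> rw [h] <;> simp

lemma mem_Icc_of_mem_convexHull [Fintype L] {p : P} {q : L → ℝ} (hq : q ∈ convexHull ℝ (M.Selections p))
    (l : L) : q l ∈ Icc (0 : ℝ) 1 := by
  have hconv : Convex ℝ (Set.pi univ fun _ : L => Icc (0 : ℝ) 1) :=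
    convex_pi fun _ _ => convex_Icc _ _
  have hsub : M.Selections p ⊆ Set.pi univ fun _ : L => Icc (0 : ℝ) 1 :=
    fun q hq l _ => M.mem_Icc_of_mem_selections hq l
  exact convexHull_min hsub hconv hq l (mem_univ l)

lemma finite_selections [Fintype L] (p : P) : (M.Selections p).Finite := by
  refine (Set.Finite.pi' (t := fun _ : L => ({0, 1} : Set ℝ)) fun _ => toFinite _).subset ?_
  intro q hq l
  simpa using hq.1 l

/-- The space of pairs `(lam, mu)` of multiplier vectors. -/
abbrev Multipliers (L : Type*) := EuclideanSpace ℝ (L ⊕ L)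

/-- The weighted number of participants `∑ l, (lam l + mu l) q l x_l^p`. -/
def selectionValue [Fintype L] (p : P) (v : Multipliers L) (q : L → ℝ) : ℝ :=
  ∑ l, (v (Sum.inl l) + v (Sum.inr l)) * q l * M.x p l

/-- The largest weighted number of participants of a selection in state `p`. -/
def bestValue [Fintype L] (p : P) (v : Multipliers L) : ℝ :=
  ⨆ q : M.Selections p, M.selectionValue p v q

lemma le_bestValue [Fintype L] {p : P} (v : Multipliers L) {q : L → ℝ} (hq : q ∈ M.Selections p) :
    M.selectionValue p v q ≤ M.bestValue p v := by
  have := (M.finite_selections p).to_subtype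
  exact le_ciSup (f := fun q : M.Selections p => M.selectionValue p v q)
    (Set.finite_range _).bddAbove ⟨q, hq⟩

lemma le_bestValue_of_mem_convexHull [Fintype L] {p : P} (v : Multipliers L) {q : L → ℝ}
    (hq : q ∈ convexHull ℝ (M.Selections p)) : M.selectionValue p v q ≤ M.bestValue p v := by
  have hlin : IsLinearMap ℝ (M.selectionValue p v) := by
    constructor
    · intro q q'
      simp only [selectionValue, ← Finset.sum_add_distrib, Pi.add_apply]
      exact Finset.sum_congr rfl fun l _ => by ring
    · intro t q
      simp only [selectionValue, Finset.mul_sum, Pi.smul_apply, smul_eq_mul]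
      exact Finset.sum_congr rfl fun l _ => by ring
  exact convexHull_min (fun q hq => M.le_bestValue v hq)
    (convex_halfSpace_le hlin (M.bestValue p v)) hq

lemma bestValue_eq [Fintype L] {p : P} {v : Multipliers L} {q : L → ℝ} (hq : q ∈ M.Selections p)
    (hmax : ∀ q' ∈ M.Selections p, M.selectionValue p v q' ≤ M.selectionValue p v q) :
    M.bestValue p v = M.selectionValue p v q := by
  have : Nonempty (M.Selections p) := ⟨⟨q, hq⟩⟩
  exact le_antisymm (ciSup_le fun q' => hmax q' q'.2) (M.le_bestValue v hq)

lemma abs_selectionValue_sub_le [Fintype L] (p : P) (u v : Multipliers L) (q : L → ℝ) {B : ℝ}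
    (hB : ∀ l, |q l * M.x p l| ≤ B) :
    |M.selectionValue p u q - M.selectionValue p v q| ≤ (2 * B * Fintype.card L) * ‖u - v‖ := by
  simp only [selectionValue, ← Finset.sum_sub_distrib]
  refine (Finset.abs_sum_le_sum_abs _ _).trans ?_
  have hterm : ∀ l ∈ Finset.univ, |(u (Sum.inl l) + u (Sum.inr l)) * q l * M.x p l -
      (v (Sum.inl l) + v (Sum.inr l)) * q l * M.x p l| ≤ 2 * B * ‖u - v‖ := by
    intro l _
    have h1 := PiLp.norm_apply_le (u - v) (Sum.inl l)
    have h2 := PiLp.norm_apply_le (u - v) (Sum.inr l)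
    rw [PiLp.sub_apply, Real.norm_eq_abs] at h1 h2
    have e : (u (Sum.inl l) + u (Sum.inr l)) * q l * M.x p l -
      (v (Sum.inl l) + v (Sum.inr l)) * q l * M.x p l =
      ((u (Sum.inl l) - v (Sum.inl l)) + (u (Sum.inr l) - v (Sum.inr l))) * (q l * M.x p l) := by
      ring
    rw [e, abs_mul]
    have h3 := abs_add_le (u (Sum.inl l) - v (Sum.inl l)) (u (Sum.inr l) - v (Sum.inr l))
    calc _ ≤ (2 * ‖u - v‖) * B :=
          mul_le_mul (by linarith) (hB l) (abs_nonneg _) (by positivity)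
      _ = _ := by ring
  refine (Finset.sum_le_sum hterm).trans ?_
  rw [Finset.sum_const, nsmul_eq_mul, Finset.card_univ]
  exact le_of_eq (by ring)

lemma abs_mul_x_le [Fintype N] {p : P} {q : L → ℝ} (hq : ∀ l, q l ∈ Icc (0 : ℝ) 1) (l : L) :
    |q l * M.x p l| ≤ Fintype.card N := by
  rw [abs_of_nonneg (mul_nonneg (hq l).1 (M.x_nonneg p l))]
  calc _ ≤ 1 * (Fintype.card N : ℝ) :=
        mul_le_mul (hq l).2 (M.x_le p l) (M.x_nonneg p l) zero_le_one
    _ = _ := one_mul _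

lemma abs_bestValue_sub_le [Fintype N] [Fintype L] {p : P} (hne : (M.Selections p).Nonempty) (u v : Multipliers L) :
    |M.bestValue p u - M.bestValue p v| ≤
      (2 * Fintype.card N * Fintype.card L) * ‖u - v‖ := by
  have := hne.to_subtype
  have hle : ∀ u v, M.bestValue p u - M.bestValue p v ≤
      (2 * Fintype.card N * Fintype.card L) * ‖u - v‖ := by
    intro u v
    rw [sub_le_iff_le_add]
    refine ciSup_le fun q => ?_
    have h1 := (abs_le.1 (M.abs_selectionValue_sub_le p u v q
      (M.abs_mul_x_le (M.mem_Icc_of_mem_selections q.2)))).2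
    have h2 := M.le_bestValue v q.2
    linarith
  refine abs_le.2 ⟨?_, hle u v⟩
  have := hle v u
  rw [norm_sub_rev] at this
  linarith

lemma selectionValue_smul [Fintype L] (p : P) (t : ℝ) (v : Multipliers L) (q : L → ℝ) :
    M.selectionValue p (t • v) q = t * M.selectionValue p v q := by
  simp only [selectionValue, PiLp.smul_apply, smul_eq_mul, Finset.mul_sum]
  exact Finset.sum_congr rfl fun l _ => by ring

lemma bestValue_smul [Fintype L] (p : P) {t : ℝ} (ht : 0 ≤ t) (v : Multipliers L) :
    M.bestValue p (t • v) = t * M.bestValue p v := by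
  simp only [bestValue, selectionValue_smul]
  exact (Real.mul_iSup_of_nonneg ht _).symm

end TaskModel

lemma exists_pos_le_of_finite {ι : Type*} [Finite ι] {f : ι → ℝ} (hf : ∀ i, 0 < f i) :
    ∃ δ > 0, ∀ i, δ ≤ f i := by
  cases isEmpty_or_nonempty ι with
  | inl h => exact ⟨1, one_pos, fun i => h.elim i⟩
  | inr h =>
    obtain ⟨i, hi⟩ := Finite.exists_min f
    exact ⟨f i, hf i, hi⟩

lemma EuclideanSpace.norm_le_sum_abs {ι : Type*} [Fintype ι] (v : EuclideanSpace ℝ ι) :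
    ‖v‖ ≤ ∑ i, |v i| := by
  refine le_of_sq_le_sq ?_ (Finset.sum_nonneg fun _ _ => abs_nonneg _)
  rw [EuclideanSpace.real_norm_sq_eq]
  simp_rw [← sq_abs (v _)]
  exact Finset.sum_sq_le_sq_sum_of_nonneg fun _ _ => abs_nonneg _

/-! ### The dual function, and runs as noisy subgradient iterations. -/

namespace TaskModel

variable {N L P : Type*} (M : TaskModel N L P)

/-- The required minimum, with `-1` in place of `-∞`. -/
def minParticipants (l : L) : ℝ := (M.X l).unbotD (-1)

/-- Participation averages are nonnegative, so the real bound `-1` is as void as `-∞` and all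
constraints can be treated alike. -/
lemma le_coe_iff {l : L} {a : ℝ} (ha : 0 ≤ a) :
    M.X l ≤ (a : WithBot ℝ) ↔ M.minParticipants l ≤ a := by
  rw [minParticipants]
  cases h : M.X l with
  | bot => simpa using by linarith
  | coe X => simp

lemma minParticipants_lt {l : L} {a : ℝ} (ha : 0 < a) (h : M.X l < (a : WithBot ℝ)) :
    M.minParticipants l < a := by
  rw [minParticipants]
  cases hX : M.X l with
  | bot => simpa using by linarith
  | coe X =>
    rw [hX] at h
    simpa using h

lemma multiplierUpdate_eq {l : L} {m α c : ℝ} (h : M.X l ≠ ⊥) :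
    multiplierUpdate m α c (M.X l) = max 0 (m - α * (c - M.minParticipants l)) := by
  rw [minParticipants]
  cases hX : M.X l with
  | bot => exact absurd hX h
  | coe X => rfl

lemma sum_mul_selectionValue [Fintype L] [Fintype P] (φ : P → ℝ) (Q : P → L → ℝ)
    (v : Multipliers L) : ∑ p, φ p * M.selectionValue p v (Q p) =
      ∑ l, (v (Sum.inl l) + v (Sum.inr l)) * M.avgParticipants φ Q l := by
  simp only [selectionValue, avgParticipants, Finset.mul_sum]
  rw [Finset.sum_comm]
  exact Finset.sum_congr rfl fun l _ => Finset.sum_congr rfl fun p _ => by ring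

lemma avgParticipants_nonneg [Fintype P] {φ : P → ℝ} (hφ : ∀ p, 0 ≤ φ p) {Q : P → L → ℝ}
    (hQ : ∀ p l, Q p l ∈ Icc (0 : ℝ) 1) (l : L) : 0 ≤ M.avgParticipants φ Q l :=
  Finset.sum_nonneg fun p _ => mul_nonneg (mul_nonneg (hφ p) (hQ p l).1) (M.x_nonneg p l)

lemma avgParticipants_le [Fintype N] [Fintype P] {φ : P → ℝ} (hφ : ∀ p, 0 ≤ φ p)
    (hφ1 : ∑ p, φ p = 1) {Q : P → L → ℝ} (hQ : ∀ p l, Q p l ∈ Icc (0 : ℝ) 1) (l : L) :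
    M.avgParticipants φ Q l ≤ Fintype.card N := by
  have h : ∀ p ∈ Finset.univ, φ p * Q p l * M.x p l ≤ φ p * Fintype.card N := by
    intro p _
    rw [mul_assoc]
    exact mul_le_mul_of_nonneg_left ((le_abs_self _).trans (M.abs_mul_x_le (hQ p) l)) (hφ p)
  refine (Finset.sum_le_sum h).trans ?_
  rw [← Finset.sum_mul, hφ1, one_mul]

/-- The dual function, with the auxiliary variables restricted to `[0, b]`. -/
def dualFunction [Fintype L] [Fintype P] (φ : P → ℝ) (b : ℝ) (v : Multipliers L) : ℝ :=
  ∑ l, conjugate (M.V l) b (v (Sum.inl l)) + ∑ p, φ p * M.bestValue p v -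
    ∑ l, v (Sum.inr l) * M.minParticipants l

lemma continuous_dualFunction [Fintype N] [Fintype L] [Fintype P] (hV : ∀ l, IsUtility (M.V l))
    (hne : ∀ p, (M.Selections p).Nonempty) (φ : P → ℝ) {b : ℝ} (hb : 0 < b) :
    Continuous (M.dualFunction φ b) := by
  have happ : ∀ i : L ⊕ L, Continuous fun v : Multipliers L => v i := fun i => by fun_prop
  have hbest : ∀ p, Continuous (M.bestValue p) := fun p => by
    refine (LipschitzWith.of_dist_le_mul (K := (2 * Fintype.card N * Fintype.card L : ℝ).toNNReal)
      fun u v => ?_).continuous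
    rw [Real.coe_toNNReal _ (by positivity), Real.dist_eq, dist_eq_norm]
    exact M.abs_bestValue_sub_le (hne p) u v
  refine ((continuous_finsetSum _ fun l _ =>
    ((hV l).continuous_conjugate hb).comp (happ (Sum.inl l))).add
    (continuous_finsetSum _ fun p _ => (hbest p).const_mul (φ p))).sub
    (continuous_finsetSum _ fun l _ => (happ (Sum.inr l)).mul_const _)

lemma dualFunction_coercive [Fintype N] [Fintype L] [Fintype P] (hV : ∀ l, IsUtility (M.V l))
    {φ : P → ℝ} (hφ : ∀ p, 0 ≤ φ p) (hφ1 : ∑ p, φ p = 1) (hslater : M.IsStrictlyFeasible φ)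
    {b : ℝ} (hb : Fintype.card N ≤ b) : ∃ δ > 0, ∃ C : ℝ, ∀ v : Multipliers L, (∀ i, 0 ≤ v i) →
      δ * ‖v‖ - C ≤ M.dualFunction φ b v := by
  obtain ⟨Q, hQ, hs⟩ := hslater
  have hQI : ∀ p l, Q p l ∈ Icc (0 : ℝ) 1 := fun p l => M.mem_Icc_of_mem_convexHull (hQ p) l
  set a := M.avgParticipants φ Q with ha
  have ha0 : ∀ l, 0 < a l := fun l => (hs l).2
  -- Testing the conjugates with auxiliary value `a l / 2` leaves slack `a l / 2` for the first
  -- multiplier of each task, and strict feasibility leaves `a l - X l` for the second; `δ` bounds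
  -- both from below.
  obtain ⟨δ, hδ, hδa⟩ := exists_pos_le_of_finite
    (f := fun l => min (a l / 2) (a l - M.minParticipants l)) fun l =>
      lt_min (half_pos (ha0 l)) (sub_pos.2 (M.minParticipants_lt (ha0 l) (hs l).1))
  refine ⟨δ, hδ, -∑ l, (M.V l (a l / 2)).toReal, fun v hv => ?_⟩
  have h1 : ∑ l, ((M.V l (a l / 2)).toReal - v (Sum.inl l) * (a l / 2)) ≤
      ∑ l, conjugate (M.V l) b (v (Sum.inl l)) := Finset.sum_le_sum fun l _ =>
    (hV l).le_conjugate _ ((hV l).mem_effDomain (half_pos (ha0 l)))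
      (by linarith [M.avgParticipants_le hφ hφ1 hQI l, ha0 l])
  have h2 : ∑ l, (v (Sum.inl l) + v (Sum.inr l)) * a l ≤ ∑ p, φ p * M.bestValue p v := by
    rw [ha, ← M.sum_mul_selectionValue]
    exact Finset.sum_le_sum fun p _ =>
      mul_le_mul_of_nonneg_left (M.le_bestValue_of_mem_convexHull v (hQ p)) (hφ p)
  have h3 : δ * ‖v‖ ≤ ∑ l, (v (Sum.inl l) * (a l / 2) +
      v (Sum.inr l) * (a l - M.minParticipants l)) := by
    refine (mul_le_mul_of_nonneg_left (EuclideanSpace.norm_le_sum_abs v) hδ.le).trans ?_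
    rw [Fintype.sum_sum_type, ← Finset.sum_add_distrib, Finset.mul_sum]
    refine Finset.sum_le_sum fun l _ => ?_
    rw [abs_of_nonneg (hv _), abs_of_nonneg (hv _)]
    have e1 := mul_le_mul_of_nonneg_left ((hδa l).trans (min_le_left _ _)) (hv (Sum.inl l))
    have e2 := mul_le_mul_of_nonneg_left ((hδa l).trans (min_le_right _ _)) (hv (Sum.inr l))
    linarith
  have h4 : ∑ l, (v (Sum.inl l) * (a l / 2) + v (Sum.inr l) * (a l - M.minParticipants l)) +
      ∑ l, (M.V l (a l / 2)).toReal =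
      ∑ l, ((M.V l (a l / 2)).toReal - v (Sum.inl l) * (a l / 2)) +
      ∑ l, (v (Sum.inl l) + v (Sum.inr l)) * a l - ∑ l, v (Sum.inr l) * M.minParticipants l := by
    rw [← Finset.sum_add_distrib, ← Finset.sum_add_distrib, ← Finset.sum_sub_distrib]
    exact Finset.sum_congr rfl fun l _ => by ring
  rw [dualFunction]
  linarith

open Classical in
/-- The multipliers of a run in one round; those of void constraints are set to zero. -/
def multipliers (lam mu : ℕ → L → ℝ) (r : ℕ) : Multipliers L :=
  WithLp.toLp 2 (Sum.elim (lam r) fun l => if M.X l = ⊥ then 0 else mu r l)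

/-- The stochastic subgradient of the dual function in one round of a run. -/
def subgradient (s : ℕ → P) (Y : L → ℝ → ℝ) (lam q : ℕ → L → ℝ) (r : ℕ) : Multipliers L :=
  WithLp.toLp 2 (Sum.elim (fun l => q r l * M.x (s r) l - Y l (lam r l))
    fun l => q r l * M.x (s r) l - M.minParticipants l)

namespace IsRun

variable {M} [Fintype L] {α : ℕ → ℝ} {s : ℕ → P} {Y : L → ℝ → ℝ} {lam mu q : ℕ → L → ℝ}

lemma selection_mem (hR : M.IsRun α s Y lam mu q) (r : ℕ) (l : L) : q r l ∈ Icc (0 : ℝ) 1 :=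
  M.mem_Icc_of_mem_selections (hR.select_mem r) l

lemma participants_nonneg (hR : M.IsRun α s Y lam mu q) (r : ℕ) (l : L) :
    0 ≤ q r l * M.x (s r) l := mul_nonneg (hR.selection_mem r l).1 (M.x_nonneg _ _)

lemma participants_le [Fintype N] (hR : M.IsRun α s Y lam mu q) (r : ℕ) (l : L) :
    q r l * M.x (s r) l ≤ Fintype.card N :=
  (le_abs_self _).trans (M.abs_mul_x_le (hR.selection_mem r) l)

lemma aux_mem (hR : M.IsRun α s Y lam mu q) (hV : ∀ l, IsUtility (M.V l)) (r : ℕ) (l : L) :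
    Y l (lam r l) ∈ effDomain (M.V l) :=
  ((hV l).maximizer (hR.aux_nonneg r l) (hR.aux_max r l)).1

lemma aux_le (hR : M.IsRun α s Y lam mu q) (hV : ∀ l, IsUtility (M.V l)) (r : ℕ) (l : L) :
    ∀ u ∈ effDomain (M.V l), (M.V l u).toReal - lam r l * u ≤
      (M.V l (Y l (lam r l))).toReal - lam r l * Y l (lam r l) :=
  ((hV l).maximizer (hR.aux_nonneg r l) (hR.aux_max r l)).2

lemma exists_aux_le [Fintype N] (hR : M.IsRun α s Y lam mu q) (hV : ∀ l, IsUtility (M.V l))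
    (hα : IsStepSize α) : ∃ B, ∀ r l, Y l (lam r l) ≤ B := by
  have h : ∀ l, ∃ B, ∀ r, Y l (lam r l) ≤ B := by
    intro l
    refine exists_response_le (lam := fun r => lam r l) hα.pos hα.tendsto_zero
      (fun r => hR.participants_le r l) (fun r => hR.aux_nonneg r l) (fun r t hrt => ?_)
      (fun r => hR.lam_succ r l)
    have h1 := hR.aux_le hV r l _ (hR.aux_mem hV t l)
    have h2 := hR.aux_le hV t l _ (hR.aux_mem hV r l)
    nlinarith
  choose B hB using h
  refine ⟨∑ l, |B l|, fun r l => (hB l r).trans ((le_abs_self _).trans ?_)⟩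
  exact Finset.single_le_sum (f := fun l => |B l|) (fun _ _ => abs_nonneg _) (Finset.mem_univ l)

lemma lam_nonneg (hR : M.IsRun α s Y lam mu q) (r : ℕ) (l : L) : 0 ≤ lam r l := by
  cases r with
  | zero => exact hR.lam_zero l
  | succ r => rw [hR.lam_succ]; exact le_max_left _ _

lemma multipliers_nonneg (hR : M.IsRun α s Y lam mu q) (r : ℕ) (i : L ⊕ L) :
    0 ≤ M.multipliers lam mu r i := by
  rcases i with l | l
  · exact hR.lam_nonneg r l
  · simp only [multipliers, Sum.elim_inr]
    split_ifs with h
    · exact le_rfl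
    · cases r with
      | zero => exact hR.mu_zero l
      | succ r =>
        rw [hR.mu_succ, M.multiplierUpdate_eq h]
        exact le_max_left _ _

lemma multipliers_succ (hR : M.IsRun α s Y lam mu q) (hα : ∀ r, 0 < α r) (r : ℕ) (i : L ⊕ L) :
    M.multipliers lam mu (r + 1) i =
      max 0 (M.multipliers lam mu r i - α r * M.subgradient s Y lam q r i) := by
  rcases i with l | l
  · exact hR.lam_succ r l
  · simp only [multipliers, subgradient, Sum.elim_inr]
    split_ifs with h
    -- For a void constraint the subgradient coordinate is participation plus 1, so the projected
    -- step keeps a zero multiplier at zero.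
    · have h1 := mul_nonneg (hα r).le
        (show 0 ≤ q r l * M.x (s r) l - M.minParticipants l by
          rw [minParticipants, h]
          simpa using by linarith [hR.participants_nonneg r l])
      exact (max_eq_left (by linarith)).symm
    · rw [hR.mu_succ, M.multiplierUpdate_eq h]

lemma multipliers_eq (hR : M.IsRun α s Y lam mu q) (r : ℕ) (l : L) :
    M.multipliers lam mu (r + 1) (Sum.inr l) = mu (r + 1) l := by
  simp only [multipliers, Sum.elim_inr]
  split_ifs with h
  · rw [hR.mu_succ, h]
    rfl
  · rfl

lemma norm_sq_sub_le (hR : M.IsRun α s Y lam mu q) (hα : ∀ r, 0 < α r) (r : ℕ)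
    {θ : Multipliers L} (hθ : ∀ i, 0 ≤ θ i) : ‖M.multipliers lam mu (r + 1) - θ‖ ^ 2 ≤
      ‖M.multipliers lam mu r - α r • M.subgradient s Y lam q r - θ‖ ^ 2 := by
  rw [EuclideanSpace.real_norm_sq_eq, EuclideanSpace.real_norm_sq_eq]
  refine Finset.sum_le_sum fun i _ => ?_
  simp only [PiLp.sub_apply, PiLp.smul_apply, smul_eq_mul]
  rw [hR.multipliers_succ hα]
  have h := hθ i
  rcases le_total (M.multipliers lam mu r i - α r * M.subgradient s Y lam q r i) 0 with h1 | h1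
  · rw [max_eq_left h1]
    nlinarith
  · rw [max_eq_right h1]

lemma norm_subgradient_le [Fintype N] (hR : M.IsRun α s Y lam mu q) {b : ℝ}
    (hb : ∀ r l, Y l (lam r l) ≤ b) (r : ℕ) : ‖M.subgradient s Y lam q r‖ ≤
      ∑ _l : L, ((Fintype.card N : ℝ) + b) + ∑ l, (Fintype.card N + |M.minParticipants l|) := by
  refine (EuclideanSpace.norm_le_sum_abs _).trans ?_
  rw [Fintype.sum_sum_type]
  refine add_le_add (Finset.sum_le_sum fun l _ => ?_) (Finset.sum_le_sum fun l _ => ?_)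
  · simp only [subgradient, Sum.elim_inl]
    refine (abs_sub _ _).trans ?_
    rw [abs_of_nonneg (hR.participants_nonneg r l), abs_of_nonneg (hR.aux_nonneg r l)]
    exact add_le_add (hR.participants_le r l) (hb r l)
  · simp only [subgradient, Sum.elim_inr]
    refine (abs_sub _ _).trans ?_
    rw [abs_of_nonneg (hR.participants_nonneg r l)]
    exact add_le_add (hR.participants_le r l) le_rfl

lemma inner_subgradient (s : ℕ → P) (Y : L → ℝ → ℝ) (lam q : ℕ → L → ℝ) (r : ℕ)
    (v : Multipliers L) : inner ℝ (M.subgradient s Y lam q r) v =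
      M.selectionValue (s r) v (q r) - ∑ l, v (Sum.inl l) * Y l (lam r l) -
        ∑ l, v (Sum.inr l) * M.minParticipants l := by
  rw [PiLp.inner_apply, Fintype.sum_sum_type, selectionValue, ← Finset.sum_sub_distrib,
    ← Finset.sum_sub_distrib, ← Finset.sum_add_distrib]
  refine Finset.sum_congr rfl fun l _ => ?_
  simp only [subgradient, Sum.elim_inl, Sum.elim_inr, RCLike.inner_apply, conj_trivial]
  ring

/-- The index starts at 1 because the initial multiplier of a void constraint may be positive, while
`multipliers` sets it to zero. The resulting selection error affects round 0 only. -/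
lemma bestValue_eq (hR : M.IsRun α s Y lam mu q) (r : ℕ) :
    M.bestValue (s (r + 1)) (M.multipliers lam mu (r + 1)) =
      M.selectionValue (s (r + 1)) (M.multipliers lam mu (r + 1)) (q (r + 1)) := by
  refine M.bestValue_eq (hR.select_mem _) fun q' hq' => ?_
  simp only [selectionValue, hR.multipliers_eq]
  exact hR.select_max (r + 1) q' hq'

lemma sum_stateDeviation_mul [Fintype P] (φ : P → ℝ) (s : ℕ → P) (r : ℕ) (f : P → ℝ) :
    ∑ p, stateDeviation φ s p r * f p = f (s r) - ∑ p, φ p * f p := by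
  classical
  simp only [stateDeviation, sub_mul, Finset.sum_sub_distrib, ite_mul, one_mul, zero_mul,
    Finset.sum_ite_eq, Finset.mem_univ, if_true]

/-- The multipliers of a run follow a noisy projected subgradient iteration. -/
theorem exists_noisySubgradient [Fintype N] [Fintype P] (hR : M.IsRun α s Y lam mu q)
    (hV : ∀ l, IsUtility (M.V l)) (hα : IsStepSize α) {φ : P → ℝ} (hφ : ∀ p, 0 ≤ φ p)
    (hφ1 : ∑ p, φ p = 1) (hslater : M.IsStrictlyFeasible φ)
    (hs : ∀ p, BlockNull (stateDeviation φ s p)) :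
    ∃ b G δ C, 0 < b ∧ (∀ r l, Y l (lam r l) ≤ b) ∧
      NoisySubgradient α (stateDeviation φ s) {v : Multipliers L | ∀ i, 0 ≤ v i}
        (M.dualFunction φ b) M.bestValue (M.multipliers lam mu) (M.subgradient s Y lam q)
        (fun r => M.bestValue (s r) (M.multipliers lam mu r) -
          M.selectionValue (s r) (M.multipliers lam mu r) (q r)) G
        (2 * Fintype.card N * Fintype.card L) δ C := by
  obtain ⟨B, hB⟩ := hR.exists_aux_le hV hα
  -- The cap must exceed all responses of the run, so that it is inactive, and all attainable
  -- participation averages, for coercivity; 1 makes it positive, hence a point of finite utility.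
  set b : ℝ := max (max B (Fintype.card N)) 1 with hb
  have hbB : ∀ r l, Y l (lam r l) ≤ b := fun r l =>
    (hB r l).trans ((le_max_left _ _).trans (le_max_left _ _))
  have hbN : (Fintype.card N : ℝ) ≤ b := (le_max_right _ _).trans (le_max_left _ _)
  have hb0 : 0 < b := one_pos.trans_le (le_max_right _ _)
  have hne : ∀ p, (M.Selections p).Nonempty := by
    obtain ⟨Q, hQ, -⟩ := hslater
    exact fun p => convexHull_nonempty_iff.1 ⟨_, hQ p⟩
  obtain ⟨δ, hδ, C, hC⟩ := M.dualFunction_coercive hV hφ hφ1 hslater hbN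
  have hφle : ∀ p, φ p ≤ 1 := fun p => hφ1 ▸ Finset.single_le_sum (fun p _ => hφ p)
    (Finset.mem_univ p)
  exact ⟨b, ∑ _l : L, ((Fintype.card N : ℝ) + b) + ∑ l, (Fintype.card N + |M.minParticipants l|),
    δ, C, hb0, hbB,
    { stepSize := hα
      blockNull := hs
      abs_le_one := fun p r => by
        rw [stateDeviation, abs_le]
        split_ifs <;> constructor <;> linarith [hφ p, hφle p]
      isClosed := by
        simp only [ofPred_forall]
        exact isClosed_iInter fun i => isClosed_le continuous_const (by fun_prop)
      zero_mem := fun i => le_rfl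
      mem := fun r => hR.multipliers_nonneg r
      step := fun r θ hθ => hR.norm_sq_sub_le hα.pos r hθ
      norm_le := hR.norm_subgradient_le hbB
      continuous := M.continuous_dualFunction hV hne φ hb0
      pos := hδ
      coercive := hC
      lipschitz := fun p => M.abs_bestValue_sub_le (hne p)
      homogeneous := fun p t v ht => M.bestValue_smul p ht v
      error := by
        refine tendsto_const_nhds.congr' ?_
        filter_upwards [eventually_ge_atTop 1] with r hr
        obtain ⟨k, rfl⟩ := Nat.exists_eq_add_of_le' hr
        rw [hR.bestValue_eq, sub_self]
      subgradient := fun r θ hθ => by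
        set v := M.multipliers lam mu r with hv
        rw [inner_sub_right, inner_subgradient, inner_subgradient]
        -- Adding the noise to the expected support function leaves the support function of the
        -- observed state, for which the selection made is a subgradient up to the round-0 error.
        rw [sum_stateDeviation_mul φ s r fun p => M.bestValue p v - M.bestValue p θ]
        have h1 := M.le_bestValue θ (hR.select_mem r)
        have h2 : ∑ l, conjugate (M.V l) b (v (Sum.inl l)) -
            ∑ l, conjugate (M.V l) b (θ (Sum.inl l)) ≤
            ∑ l, θ (Sum.inl l) * Y l (lam r l) - ∑ l, v (Sum.inl l) * Y l (lam r l) := by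
          rw [← Finset.sum_sub_distrib, ← Finset.sum_sub_distrib]
          refine Finset.sum_le_sum fun l _ => ?_
          have e : v (Sum.inl l) = lam r l := rfl
          rw [e, (hV l).conjugate_eq (hR.aux_mem hV r l) (hbB r l) (hR.aux_le hV r l)]
          linarith [(hV l).le_conjugate (θ (Sum.inl l)) (hR.aux_mem hV r l) (hbB r l)]
        simp only [mul_sub, Finset.sum_sub_distrib, dualFunction]
        linarith }⟩

end IsRun

end TaskModel

/-! ### Average performance of a run against feasible points. -/

lemma CesaroNull.eventually_neg_le {b : ℕ → ℝ} (hb : CesaroNull b) {κ : ℝ} (hκ : 0 < κ) :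
    ∀ᶠ R : ℕ in atTop, -κ ≤ (∑ r ∈ Finset.range R, b r) / R :=
  (hb.eventually_const_lt (neg_lt_zero.2 hκ)).mono fun _ h => h.le

lemma average_add_const {R : ℕ} (hR : 0 < R) (b : ℕ → ℝ) (c : ℝ) :
    (∑ r ∈ Finset.range R, (b r + c)) / R = (∑ r ∈ Finset.range R, b r) / R + c := by
  have : (R : ℝ) ≠ 0 := by exact_mod_cast hR.ne'
  rw [Finset.sum_add_distrib, Finset.sum_const, Finset.card_range, nsmul_eq_mul]
  field_simp

lemma average_le_average {R : ℕ} {a b : ℕ → ℝ} (h : ∀ r, a r ≤ b r) :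
    (∑ r ∈ Finset.range R, a r) / R ≤ (∑ r ∈ Finset.range R, b r) / R :=
  div_le_div_of_nonneg_right (Finset.sum_le_sum fun r _ => h r) (Nat.cast_nonneg R)

/-- Jensen's inequality for averages. -/
lemma ConcaveOn.average_le {s : Set ℝ} {f : ℝ → ℝ} (hf : ConcaveOn ℝ s f) {R : ℕ} (hR : 0 < R)
    {y : ℕ → ℝ} (hy : ∀ r, y r ∈ s) : (∑ r ∈ Finset.range R, y r) / R ∈ s ∧
      (∑ r ∈ Finset.range R, f (y r)) / R ≤ f ((∑ r ∈ Finset.range R, y r) / R) := by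
  have hR' : (R : ℝ) ≠ 0 := by exact_mod_cast hR.ne'
  have h0 : ∀ r ∈ Finset.range R, (0 : ℝ) ≤ 1 / R := fun _ _ => by positivity
  have h1 : ∑ _r ∈ Finset.range R, (1 / R : ℝ) = 1 := by
    rw [Finset.sum_const, Finset.card_range, nsmul_eq_mul]
    field_simp
  have e : ∀ b : ℕ → ℝ, ∑ r ∈ Finset.range R, (1 / R : ℝ) • b r =
      (∑ r ∈ Finset.range R, b r) / R := fun b => by
    simp only [smul_eq_mul, one_div_mul_eq_div, Finset.sum_div]
  have h2 := hf.1.sum_mem h0 h1 fun r _ => hy r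
  have h3 := hf.le_map_sum h0 h1 fun r _ => hy r
  rw [e] at h2
  rw [e (fun r => f (y r)), e] at h3
  exact ⟨h2, h3⟩

lemma BlockNull.cesaroNull {z : ℕ → ℝ} (hz : BlockNull z) {Z : ℝ} (hZ : ∀ r, |z r| ≤ Z) :
    CesaroNull z := by
  simpa using hz.cesaroNull_mul hZ (c := fun _ => 1) (B := 1) (by simp) (by simp)

namespace TaskModel

variable {N L P : Type*} {M : TaskModel N L P} [Fintype L] [Fintype P]

namespace IsRun

variable {α : ℕ → ℝ} {s : ℕ → P} {Y : L → ℝ → ℝ} {lam mu q : ℕ → L → ℝ} {φ : P → ℝ}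

/-- Projection only raises a coordinate, so the subgradient coordinate is at least the decrease of
the multiplier divided by `α r`; flatness of the coordinate function makes the latter null in the
mean. -/
lemma exists_cesaroNull_le [Fintype N] (hR : M.IsRun α s Y lam mu q)
    (hV : ∀ l, IsUtility (M.V l)) (hα : IsStepSize α) (hφ : ∀ p, 0 ≤ φ p)
    (hφ1 : ∑ p, φ p = 1) (hslater : M.IsStrictlyFeasible φ)
    (hs : ∀ p, BlockNull (stateDeviation φ s p)) (i : L ⊕ L) :
    ∃ b, CesaroNull b ∧ ∀ r, b r ≤ M.subgradient s Y lam q r i := by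
  obtain ⟨b, G, δ, C, -, -, hN⟩ := hR.exists_noisySubgradient hV hα hφ hφ1 hslater hs
  refine ⟨_, hN.flat (U := fun v => v i) (LU := 1) fun u v => ?_, fun r => ?_⟩
  · rw [one_mul]
    exact PiLp.norm_apply_le (u - v) i
  · rw [div_le_iff₀ (hα.pos r), hR.multipliers_succ hα.pos]
    linarith [le_max_right 0
      (M.multipliers lam mu r i - α r * M.subgradient s Y lam q r i)]

lemma eventually_minParticipants_le [Fintype N] (hR : M.IsRun α s Y lam mu q)
    (hV : ∀ l, IsUtility (M.V l)) (hα : IsStepSize α) (hφ : ∀ p, 0 ≤ φ p)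
    (hφ1 : ∑ p, φ p = 1) (hslater : M.IsStrictlyFeasible φ)
    (hs : ∀ p, BlockNull (stateDeviation φ s p)) (l : L) {κ : ℝ} (hκ : 0 < κ) :
    ∀ᶠ R in atTop, M.minParticipants l ≤ M.timeAverage s q R l + κ := by
  obtain ⟨b, hb, hle⟩ := hR.exists_cesaroNull_le hV hα hφ hφ1 hslater hs (Sum.inr l)
  filter_upwards [hb.eventually_neg_le hκ, eventually_gt_atTop 0] with R h1 h2
  have h3 := average_le_average (R := R) (b := fun r => q r l * M.x (s r) l)
    (a := fun r => b r + M.minParticipants l) fun r => by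
      have : b r ≤ q r l * M.x (s r) l - M.minParticipants l := hle r
      linarith
  rw [average_add_const h2] at h3
  rw [timeAverage]
  linarith

/-- Comparison of a round of a run with a feasible point of the relaxed problem. -/
lemma le_inner_subgradient (hR : M.IsRun α s Y lam mu q) (hV : ∀ l, IsUtility (M.V l))
    {Q : P → L → ℝ} (hQ : ∀ p, Q p ∈ convexHull ℝ (M.Selections p))
    (hX : ∀ l, M.minParticipants l ≤ M.avgParticipants φ Q l)
    (hdom : ∀ l, M.avgParticipants φ Q l ∈ effDomain (M.V l)) (r : ℕ) :
    ∑ l, (M.V l (M.avgParticipants φ Q l)).toReal - ∑ l, (M.V l (Y l (lam r l))).toReal +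
      (∑ p, stateDeviation φ s p r * M.selectionValue p (M.multipliers lam mu r) (Q p) -
        (M.bestValue (s r) (M.multipliers lam mu r) -
          M.selectionValue (s r) (M.multipliers lam mu r) (q r))) ≤
      inner ℝ (M.subgradient s Y lam q r) (M.multipliers lam mu r) := by
  set v := M.multipliers lam mu r with hv
  set a := M.avgParticipants φ Q with ha
  rw [inner_subgradient, sum_stateDeviation_mul φ s r fun p => M.selectionValue p v (Q p),
    M.sum_mul_selectionValue]
  have h1 := M.le_bestValue_of_mem_convexHull v (hQ (s r))
  have h2 : ∑ l, ((M.V l (a l)).toReal - v (Sum.inl l) * a l) ≤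
      ∑ l, ((M.V l (Y l (lam r l))).toReal - v (Sum.inl l) * Y l (lam r l)) :=
    Finset.sum_le_sum fun l _ => hR.aux_le hV r l (a l) (hdom l)
  have h3 : ∑ l, v (Sum.inr l) * M.minParticipants l ≤ ∑ l, v (Sum.inr l) * a l :=
    Finset.sum_le_sum fun l _ =>
      mul_le_mul_of_nonneg_left (hX l) (hR.multipliers_nonneg r (Sum.inr l))
  simp only [Finset.sum_sub_distrib, add_mul, Finset.sum_add_distrib] at h2 ⊢
  linarith

/-- Up to small errors, the time averages dominate points of at least the utility of any feasible
point of the relaxed problem. -/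
theorem exists_eventually_le [Fintype N] (hR : M.IsRun α s Y lam mu q)
    (hV : ∀ l, IsUtility (M.V l)) (hα : IsStepSize α) (hφ : ∀ p, 0 ≤ φ p)
    (hφ1 : ∑ p, φ p = 1) (hslater : M.IsStrictlyFeasible φ)
    (hs : ∀ p, BlockNull (stateDeviation φ s p))
    {Q : P → L → ℝ} (hQ : ∀ p, Q p ∈ convexHull ℝ (M.Selections p))
    (hX : ∀ l, M.minParticipants l ≤ M.avgParticipants φ Q l)
    (hdom : ∀ l, M.avgParticipants φ Q l ∈ effDomain (M.V l)) :
    ∃ b : ℝ, ∀ κ : ℝ, 0 < κ → ∀ᶠ R in atTop, ∃ y : L → ℝ,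
      (∀ l, y l ∈ effDomain (M.V l) ∧ y l ≤ b) ∧
      ∑ l, (M.V l (M.avgParticipants φ Q l)).toReal - κ ≤ ∑ l, (M.V l (y l)).toReal ∧
      ∀ l, y l - κ ≤ M.timeAverage s q R l := by
  obtain ⟨b, G, δ, C, hb0, hb, hN⟩ := hR.exists_noisySubgradient hV hα hφ hφ1 hslater hs
  refine ⟨b, fun κ hκ => ?_⟩
  set U : ℝ := ∑ l, (M.V l (M.avgParticipants φ Q l)).toReal with hU
  set A : ℝ := |U - ∑ l, (M.V l b).toReal| with hA
  have hA0 : 0 ≤ A := abs_nonneg _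
  set c₀ : ℝ := (M.dualFunction φ b 0 + C) / δ with hc₀
  have hc₀0 : 0 ≤ c₀ := by
    have := hN.coercive 0 hN.zero_mem
    rw [norm_zero] at this
    exact div_nonneg (by linarith) hN.pos.le
  -- The mean of `1 - w r` is asymptotically at most `c₀ / H`. It costs `A` times this in utility
  -- and `b` times this in participation, so this `H` keeps each loss below `κ / 2`.
  set H : ℝ := 2 * ((A + b) * c₀) / κ + 1 with hH
  have hH0 : 0 < H := by positivity
  have hHκ : (A + b) * (c₀ / H) ≤ κ / 2 := by
    rw [← mul_div_assoc, div_le_iff₀ hH0, hH]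
    field_simp
    nlinarith
  obtain ⟨b₁, hb₁, hle₁⟩ := hN.exists_cesaroNull_inner_le hH0
  obtain ⟨b₂, hb₂, hle₂⟩ := hN.exists_one_sub_radialWeight_le hH0
  choose b₃ hb₃ hle₃ using fun l : L =>
    hR.exists_cesaroNull_le hV hα hφ hφ1 hslater hs (Sum.inl l)
  have hnoise := hN.cesaroNull_noise hH0
    (f := fun p v => M.selectionValue p v (Q p))
    (Lip' := 2 * Fintype.card N * Fintype.card L)
    (fun p u v => M.abs_selectionValue_sub_le p u v (Q p)
      (M.abs_mul_x_le (M.mem_Icc_of_mem_convexHull (hQ p))))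
    (fun p t v _ => M.selectionValue_smul p t v (Q p))
  set w : ℕ → ℝ := fun r => radialWeight H (M.multipliers lam mu r) with hw
  have hw0 : ∀ r, 0 < w r := fun r => radialWeight_pos hH0 _
  have hw1 : ∀ r, w r ≤ 1 := fun r => radialWeight_le_one hH0 _
  have hw2 : ∀ r, 1 - w r ≤ c₀ / H + b₂ r := fun r => by
    have := hle₂ r
    rwa [← div_div] at this
  have hbmem : ∀ l, b ∈ effDomain (M.V l) := fun l => (hV l).mem_effDomain hb0
  -- Only the weighted part of each round is controlled. The missing weight is placed at `b`, where
  -- the utility is finite, so that plain averages and Jensen's inequality still apply.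
  set y : ℕ → L → ℝ := fun r l => w r * Y l (lam r l) + (1 - w r) * b with hy
  have hymem : ∀ r l, y r l ∈ effDomain (M.V l) := fun r l =>
    (hV l).concaveOn.1 (hR.aux_mem hV r l) (hbmem l) (hw0 r).le (sub_nonneg.2 (hw1 r)) (by ring)
  have hyb : ∀ r l, y r l ≤ b := fun r l => by
    have := mul_le_mul_of_nonneg_left (hb r l) (hw0 r).le
    simp only [hy]
    linarith
  have hyutil : ∀ r, w r * (∑ p, stateDeviation φ s p r *
      M.selectionValue p (M.multipliers lam mu r) (Q p) -
        (M.bestValue (s r) (M.multipliers lam mu r) -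
          M.selectionValue (s r) (M.multipliers lam mu r) (q r))) - b₁ r - A * b₂ r +
      (U - A * (c₀ / H)) ≤ ∑ l, (M.V l (y r l)).toReal := by
    intro r
    have h1 : ∑ l, (w r * (M.V l (Y l (lam r l))).toReal + (1 - w r) * (M.V l b).toReal) ≤
        ∑ l, (M.V l (y r l)).toReal := Finset.sum_le_sum fun l _ =>
      (hV l).concaveOn.2 (hR.aux_mem hV r l) (hbmem l) (hw0 r).le (sub_nonneg.2 (hw1 r)) (by ring)
    rw [Finset.sum_add_distrib, ← Finset.mul_sum, ← Finset.mul_sum] at h1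
    have h2 := (mul_le_mul_of_nonneg_left (hR.le_inner_subgradient hV hQ hX hdom r)
      (hw0 r).le).trans (hle₁ r)
    have h3 : (1 - w r) * (U - ∑ l, (M.V l b).toReal) ≤ (1 - w r) * A :=
      mul_le_mul_of_nonneg_left (le_abs_self _) (sub_nonneg.2 (hw1 r))
    have h4 := mul_le_mul_of_nonneg_left (hw2 r) hA0
    rw [mul_add] at h2
    linarith
  have hyle : ∀ l r, b₃ l r - b * b₂ r + (-(b * (c₀ / H))) ≤
      q r l * M.x (s r) l - y r l := by
    intro l r
    have h1 : b₃ l r ≤ q r l * M.x (s r) l - Y l (lam r l) := hle₃ l r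
    have h2 := mul_le_mul_of_nonneg_left (hw2 r) hb0.le
    have h3 := mul_le_mul_of_nonneg_right (hw1 r) (hR.aux_nonneg r l)
    simp only [hy]
    linarith
  have hev₁ := ((hnoise.sub hb₁).sub (hb₂.const_mul A)).eventually_neg_le (half_pos hκ)
  have hev₂ := eventually_all.2 fun l =>
    ((hb₃ l).sub (hb₂.const_mul b)).eventually_neg_le (half_pos hκ)
  filter_upwards [hev₁, hev₂, eventually_gt_atTop 0] with R h1 h2 hR0
  have hA1 : A * (c₀ / H) ≤ (A + b) * (c₀ / H) :=
    mul_le_mul_of_nonneg_right (by linarith) (by positivity)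
  have hA2 : b * (c₀ / H) ≤ (A + b) * (c₀ / H) :=
    mul_le_mul_of_nonneg_right (by linarith) (by positivity)
  refine ⟨fun l => (∑ r ∈ Finset.range R, y r l) / R, fun l => ⟨?_, ?_⟩, ?_, fun l => ?_⟩
  · exact ((hV l).concaveOn.average_le hR0 fun r => hymem r l).1
  · have h3 := average_le_average (R := R) fun r => hyb r l
    have h4 := average_add_const hR0 (fun _ => 0) b
    simp only [zero_add, Finset.sum_const_zero, zero_div] at h4
    rwa [h4] at h3
  · have h3 : ∑ l, (∑ r ∈ Finset.range R, (M.V l (y r l)).toReal) / R ≤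
        ∑ l, (M.V l ((∑ r ∈ Finset.range R, y r l) / R)).toReal := Finset.sum_le_sum fun l _ =>
      ((hV l).concaveOn.average_le hR0 fun r => hymem r l).2
    rw [← Finset.sum_div, Finset.sum_comm] at h3
    have h4 := (average_le_average (R := R) hyutil).trans h3
    rw [average_add_const hR0] at h4
    linarith
  · have h3 := average_le_average (R := R) (hyle l)
    rw [average_add_const hR0, Finset.sum_sub_distrib (fun r => q r l * M.x (s r) l) fun r => y r l,
      sub_div] at h3
    have h4 := h2 l
    change (∑ r ∈ Finset.range R, y r l) / R - κ ≤ (∑ r ∈ Finset.range R, q r l * M.x (s r) l) / R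
    linarith

end IsRun

/-- The time averages of any sequence of selections are close to those of mixtures. -/
lemma exists_mixture [Fintype N] {s : ℕ → P} {q : ℕ → L → ℝ} (hq : ∀ r, q r ∈ M.Selections (s r))
    (hne : ∀ p, (M.Selections p).Nonempty) (φ : P → ℝ) (R : ℕ) (hR : 0 < R) :
    ∃ Q : P → L → ℝ, (∀ p, Q p ∈ convexHull ℝ (M.Selections p)) ∧
      ∀ l, |M.timeAverage s q R l - M.avgParticipants φ Q l| ≤
        ∑ p, |(∑ r ∈ Finset.range R, stateDeviation φ s p r) / R| * Fintype.card N := by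
  classical
  set n : P → Finset ℕ := fun p => (Finset.range R).filter fun r => s r = p with hn
  -- The mixture for state `p` is the empirical mean of the selections made in that state, or any
  -- selection if the state has not occurred.
  have hQ : ∀ p, ∃ Qp ∈ convexHull ℝ (M.Selections p), ∀ l,
      ((n p).card : ℝ) * Qp l = ∑ r ∈ n p, q r l := by
    intro p
    rcases (n p).eq_empty_or_nonempty with h | h
    · obtain ⟨Qp, hQp⟩ := hne p
      exact ⟨Qp, subset_convexHull ℝ _ hQp, fun l => by simp [h]⟩
    · have hc : ((n p).card : ℝ) ≠ 0 := by exact_mod_cast h.card_pos.ne'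
      refine ⟨∑ r ∈ n p, (1 / (n p).card : ℝ) • q r,
        (convex_convexHull ℝ _).sum_mem (fun _ _ => by positivity) ?_ fun r hr => ?_, fun l => ?_⟩
      · rw [Finset.sum_const, nsmul_eq_mul]
        field_simp
      · have : s r = p := (Finset.mem_filter.1 hr).2
        exact subset_convexHull ℝ _ (this ▸ hq r)
      · rw [Finset.sum_apply, Finset.mul_sum]
        refine Finset.sum_congr rfl fun r _ => ?_
        rw [Pi.smul_apply, smul_eq_mul]
        field_simp
  choose Q hQmem hQsum using hQ
  refine ⟨Q, hQmem, fun l => ?_⟩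
  have hR' : (R : ℝ) ≠ 0 := by exact_mod_cast hR.ne'
  have hdev : ∀ p, (∑ r ∈ Finset.range R, stateDeviation φ s p r) / R =
      ((n p).card : ℝ) / R - φ p := by
    intro p
    simp only [stateDeviation, Finset.sum_sub_distrib, Finset.sum_const, Finset.card_range,
      nsmul_eq_mul, hn, Finset.card_filter, Nat.cast_sum, Nat.cast_ite, Nat.cast_one, Nat.cast_zero]
    field_simp
  have htime : M.timeAverage s q R l = ∑ p, ((n p).card : ℝ) / R * (Q p l * M.x p l) := by
    have h1 : ∑ r ∈ Finset.range R, q r l * M.x (s r) l =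
        ∑ p, ((n p).card : ℝ) * Q p l * M.x p l := by
      rw [← Finset.sum_fiberwise (Finset.range R) s]
      refine Finset.sum_congr rfl fun p _ => ?_
      rw [hQsum, Finset.sum_mul]
      refine Finset.sum_congr rfl fun r hr => ?_
      rw [(Finset.mem_filter.1 hr).2]
    rw [timeAverage, h1, Finset.sum_div]
    exact Finset.sum_congr rfl fun p _ => by ring
  rw [htime, avgParticipants, ← Finset.sum_sub_distrib]
  refine (Finset.abs_sum_le_sum_abs _ _).trans (Finset.sum_le_sum fun p _ => ?_)
  rw [hdev]
  have e : ((n p).card : ℝ) / R * (Q p l * M.x p l) - φ p * Q p l * M.x p l =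
      (((n p).card : ℝ) / R - φ p) * (Q p l * M.x p l) := by ring
  rw [e, abs_mul]
  exact mul_le_mul_of_nonneg_left
    (M.abs_mul_x_le (M.mem_Icc_of_mem_convexHull (hQmem p)) l) (abs_nonneg _)

end TaskModel

/-! ### The optimum and the limit of extended-valued utilities. -/

lemma EReal.continuousOn_sum {X ι : Type*} [TopologicalSpace X] {s : Set X} (t : Finset ι)
    {f : ι → X → EReal} (hf : ∀ i, ContinuousOn (f i) s) (htop : ∀ i, ∀ x ∈ s, f i x ≠ ⊤) :
    ContinuousOn (fun x => ∑ i ∈ t, f i x) s ∧ ∀ x ∈ s, ∑ i ∈ t, f i x ≠ ⊤ := by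
  classical
  induction t using Finset.induction_on with
  | empty => simpa using continuousOn_const
  | insert i t hi ih =>
    simp only [Finset.sum_insert hi]
    refine ⟨fun x hx => ?_, fun x hx => EReal.add_ne_top (htop i x hx) (ih.2 x hx)⟩
    exact Tendsto.comp (EReal.continuousAt_add (p := (f i x, ∑ i ∈ t, f i x)) (Or.inl (htop i x hx))
      (Or.inr (ih.2 x hx))) ((hf i x hx).prodMk_nhds (ih.1 x hx))

lemma EReal.sum_coe {ι : Type*} (t : Finset ι) (f : ι → ℝ) :
    ∑ i ∈ t, (f i : EReal) = ((∑ i ∈ t, f i : ℝ) : EReal) := by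
  classical
  induction t using Finset.induction_on with
  | empty => simp
  | insert i t hi ih => rw [Finset.sum_insert hi, Finset.sum_insert hi, ih, EReal.coe_add]

namespace TaskModel

variable {N L P : Type*} {M : TaskModel N L P}

lemma continuous_avgParticipants [Fintype P] (φ : P → ℝ) : Continuous (M.avgParticipants φ) := by
  refine continuous_pi fun l => continuous_finsetSum _ fun p _ => ?_
  fun_prop

variable [Fintype L]

lemma isCompact_mixtures (M : TaskModel N L P) :
    IsCompact {Q : P → L → ℝ | ∀ p, Q p ∈ convexHull ℝ (M.Selections p)} := by
  have h := isCompact_univ_pi fun p => (M.finite_selections p).isCompact_convexHull (𝕜 := ℝ)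
  convert h using 1
  ext Q
  simp

lemma continuousOn_utility (hV : ∀ l, IsUtility (M.V l)) :
    ContinuousOn M.utility {a | ∀ l, 0 ≤ a l} := by
  refine (EReal.continuousOn_sum (f := fun l (a : L → ℝ) => M.V l (a l)) Finset.univ (fun l => ?_)
    fun l a (ha : ∀ l, 0 ≤ a l) => (hV l).ne_top _ (ha l)).1
  refine ContinuousOn.comp (t := Ici 0) (hV l).continuousOn (continuous_apply l).continuousOn ?_
  exact fun a ha => ha l

lemma utility_eq_coe (hV : ∀ l, IsUtility (M.V l)) {y : L → ℝ}
    (hy : ∀ l, y l ∈ effDomain (M.V l)) :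
    M.utility y = ((∑ l, (M.V l (y l)).toReal : ℝ) : EReal) := by
  rw [utility, ← EReal.sum_coe]
  exact Finset.sum_congr rfl fun l _ => ((hV l).coe_toReal (hy l)).symm

lemma mem_effDomain_of_utility_ne_bot {a : L → ℝ} (ha : ∀ l, 0 ≤ a l) (h : M.utility a ≠ ⊥)
    (l : L) : a l ∈ effDomain (M.V l) := by
  classical
  refine ⟨ha l, fun hbot => h ?_⟩
  rw [utility, ← Finset.add_sum_erase _ _ (Finset.mem_univ l), hbot, EReal.bot_add]

lemma utility_mono (hV : ∀ l, IsUtility (M.V l)) {a a' : L → ℝ} (ha : ∀ l, 0 ≤ a l)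
    (h : ∀ l, a l ≤ a' l) : M.utility a ≤ M.utility a' :=
  Finset.sum_le_sum fun l _ => (hV l).mono (ha l) ((ha l).trans (h l)) (h l)

namespace IsRun

lemma timeAverage_mem [Fintype N] {α : ℕ → ℝ} {s : ℕ → P} {Y : L → ℝ → ℝ}
    {lam mu q : ℕ → L → ℝ} (hR : M.IsRun α s Y lam mu q) (R : ℕ) (l : L) :
    M.timeAverage s q R l ∈ Icc (0 : ℝ) (Fintype.card N) := by
  refine ⟨div_nonneg (Finset.sum_nonneg fun r _ => hR.participants_nonneg r l) (Nat.cast_nonneg R),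
    div_le_of_le_mul₀ (Nat.cast_nonneg R) (Nat.cast_nonneg _) ?_⟩
  refine (Finset.sum_le_sum fun r _ => hR.participants_le r l).trans ?_
  simp [mul_comm]

end IsRun

variable [Fintype P] {φ : P → ℝ}

lemma isRelaxedFeasible_iff (hφ : ∀ p, 0 ≤ φ p) {Q : P → L → ℝ} :
    M.IsRelaxedFeasible φ Q ↔ (∀ p, Q p ∈ convexHull ℝ (M.Selections p)) ∧
      ∀ l, M.minParticipants l ≤ M.avgParticipants φ Q l := by
  refine and_congr_right fun hQ => forall_congr' fun l => ?_
  exact M.le_coe_iff (M.avgParticipants_nonneg hφ (fun p l => M.mem_Icc_of_mem_convexHull (hQ p) l) l)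

/-- The feasible set is compact and the utility is continuous with values in `EReal`. The strictly
feasible point has finite utility, so every task has finite utility at the maximizer. -/
lemma exists_optimum (hV : ∀ l, IsUtility (M.V l)) (hφ : ∀ p, 0 ≤ φ p)
    (hslater : M.IsStrictlyFeasible φ) : ∃ Q, M.IsRelaxedFeasible φ Q ∧
      (∀ l, M.avgParticipants φ Q l ∈ effDomain (M.V l)) ∧
      ∀ Q', M.IsRelaxedFeasible φ Q' →
        M.utility (M.avgParticipants φ Q') ≤ M.utility (M.avgParticipants φ Q) := by
  have hnn : ∀ Q, M.IsRelaxedFeasible φ Q → ∀ l, 0 ≤ M.avgParticipants φ Q l := fun Q hQ =>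
    M.avgParticipants_nonneg hφ fun p l => M.mem_Icc_of_mem_convexHull (hQ.1 p) l
  obtain ⟨Q₀, hQ₀, hs⟩ := hslater
  have hQ₀f : M.IsRelaxedFeasible φ Q₀ := ⟨hQ₀, fun l => (hs l).1.le⟩
  have hcpt : IsCompact {Q | M.IsRelaxedFeasible φ Q} := by
    have : {Q | M.IsRelaxedFeasible φ Q} =
        {Q : P → L → ℝ | ∀ p, Q p ∈ convexHull ℝ (M.Selections p)} ∩
          {Q | ∀ l, M.minParticipants l ≤ M.avgParticipants φ Q l} := by
      ext Q
      exact isRelaxedFeasible_iff hφ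
    rw [this]
    refine M.isCompact_mixtures.inter_right ?_
    simp only [ofPred_forall]
    exact isClosed_iInter fun l => isClosed_le continuous_const
      ((continuous_apply l).comp (continuous_avgParticipants φ))
  obtain ⟨Q, hQ, hmax⟩ := hcpt.exists_isMaxOn ⟨Q₀, hQ₀f⟩
    ((continuousOn_utility hV).comp (continuous_avgParticipants φ).continuousOn fun Q hQ => hnn Q hQ)
  refine ⟨Q, hQ, ?_, fun Q' hQ' => hmax hQ'⟩
  refine mem_effDomain_of_utility_ne_bot (hnn Q hQ) fun hbot => ?_
  have h1 : M.utility (M.avgParticipants φ Q₀) ≤ M.utility (M.avgParticipants φ Q) := hmax hQ₀f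
  rw [hbot, utility_eq_coe hV fun l => (hV l).mem_effDomain (hs l).2, le_bot_iff] at h1
  exact EReal.coe_ne_bot _ h1

namespace IsRun

variable [Fintype N] {α : ℕ → ℝ} {s : ℕ → P} {Y : L → ℝ → ℝ} {lam mu q : ℕ → L → ℝ}

/-- The utility of the time averages does not asymptotically exceed the optimum. -/
lemma eventually_utility_lt (hR : M.IsRun α s Y lam mu q)
    (hV : ∀ l, IsUtility (M.V l)) (hα : IsStepSize α) (hφ : ∀ p, 0 ≤ φ p)
    (hφ1 : ∑ p, φ p = 1) (hslater : M.IsStrictlyFeasible φ)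
    (hs : ∀ p, BlockNull (stateDeviation φ s p)) {opt : EReal}
    (hopt : ∀ Q, M.IsRelaxedFeasible φ Q → M.utility (M.avgParticipants φ Q) ≤ opt)
    {b : EReal} (hb : opt < b) : ∀ᶠ R in atTop, M.utility (M.timeAverage s q R) < b := by
  by_contra hcon
  have hfreq : ∃ᶠ R in atTop, b ≤ M.utility (M.timeAverage s q R) := by
    simpa only [not_eventually, not_lt] using hcon
  obtain ⟨ρ, hρ, hρb⟩ := extraction_of_frequently_atTop
    (hfreq.and_eventually (eventually_gt_atTop 0))
  have hne : ∀ p, (M.Selections p).Nonempty := by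
    obtain ⟨Q, hQ, -⟩ := hslater
    exact fun p => convexHull_nonempty_iff.1 ⟨_, hQ p⟩
  choose Q hQ hdist using fun k => M.exists_mixture hR.select_mem hne φ (ρ k) (hρb k).2
  -- Along a subsequence of bad rounds, the approximating mixtures and the time averages share a
  -- limit. It is feasible, because the constraints hold asymptotically, and its utility is at least
  -- `b`, contradicting optimality.
  obtain ⟨Q', hQ', ψ, hψ, hlim⟩ := M.isCompact_mixtures.tendsto_subseq hQ
  have hρψ : Tendsto (fun k => ρ (ψ k)) atTop atTop := hρ.tendsto_atTop.comp hψ.tendsto_atTop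
  have hφle : ∀ p, φ p ≤ 1 := fun p => hφ1 ▸ Finset.single_le_sum (fun p _ => hφ p)
    (Finset.mem_univ p)
  have hnull : ∀ p, CesaroNull (stateDeviation φ s p) := fun p =>
    (hs p).cesaroNull (Z := 1) fun r => by
      rw [stateDeviation, abs_le]
      split_ifs <;> constructor <;> linarith [hφ p, hφle p]
  have herr : Tendsto (fun R : ℕ => ∑ p, |(∑ r ∈ Finset.range R, stateDeviation φ s p r) / R| *
      (Fintype.card N : ℝ)) atTop (𝓝 0) := by
    have := tendsto_finsetSum Finset.univ fun p (_ : p ∈ Finset.univ) =>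
      ((hnull p).abs.mul_const (Fintype.card N : ℝ))
    simpa using this
  have havg : Tendsto (fun k => M.avgParticipants φ (Q (ψ k))) atTop
      (𝓝 (M.avgParticipants φ Q')) :=
    ((continuous_avgParticipants φ).tendsto Q').comp hlim
  have htime : Tendsto (fun k => M.timeAverage s q (ρ (ψ k))) atTop
      (𝓝 (M.avgParticipants φ Q')) := by
    refine tendsto_pi_nhds.2 fun l => ?_
    have h1 : Tendsto (fun k => M.timeAverage s q (ρ (ψ k)) l - M.avgParticipants φ (Q (ψ k)) l)
        atTop (𝓝 0) :=
      squeeze_zero_norm (fun k => hdist (ψ k) l) (herr.comp hρψ)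
    have h2 := h1.add (tendsto_pi_nhds.1 havg l)
    simpa using h2
  have hQ'I : ∀ l, 0 ≤ M.avgParticipants φ Q' l :=
    M.avgParticipants_nonneg hφ fun p l => M.mem_Icc_of_mem_convexHull (hQ' p) l
  have hfeas : M.IsRelaxedFeasible φ Q' := by
    refine (isRelaxedFeasible_iff hφ).2 ⟨hQ', fun l => le_of_forall_pos_le_add fun κ hκ => ?_⟩
    refine ge_of_tendsto ((tendsto_pi_nhds.1 htime l).add_const κ) ?_
    exact hρψ.eventually (hR.eventually_minParticipants_le hV hα hφ hφ1 hslater hs l hκ)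
  have hutil : Tendsto (fun k => M.utility (M.timeAverage s q (ρ (ψ k)))) atTop
      (𝓝 (M.utility (M.avgParticipants φ Q'))) :=
    (continuousOn_utility hV _ hQ'I).tendsto.comp (tendsto_nhdsWithin_iff.2
      ⟨htime, Eventually.of_forall fun k l => (hR.timeAverage_mem _ l).1⟩)
  have h1 : b ≤ M.utility (M.avgParticipants φ Q') :=
    ge_of_tendsto hutil (Eventually.of_forall fun k => (hρb (ψ k)).1)
  exact absurd (h1.trans (hopt Q' hfeas)) (not_le.2 hb)

/-- The utility of the time averages asymptotically reaches that of any feasible point of the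
relaxed problem. -/
lemma eventually_lt_utility (hR : M.IsRun α s Y lam mu q)
    (hV : ∀ l, IsUtility (M.V l)) (hα : IsStepSize α) (hφ : ∀ p, 0 ≤ φ p)
    (hφ1 : ∑ p, φ p = 1) (hslater : M.IsStrictlyFeasible φ)
    (hs : ∀ p, BlockNull (stateDeviation φ s p)) {Q : P → L → ℝ} (hQ : M.IsRelaxedFeasible φ Q)
    (hdom : ∀ l, M.avgParticipants φ Q l ∈ effDomain (M.V l)) {b : EReal}
    (hb : b < M.utility (M.avgParticipants φ Q)) :
    ∀ᶠ R in atTop, b < M.utility (M.timeAverage s q R) := by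
  by_contra hcon
  have hfreq : ∃ᶠ R in atTop, M.utility (M.timeAverage s q R) ≤ b := by
    simpa only [not_eventually, not_lt] using hcon
  have hQ' := (isRelaxedFeasible_iff hφ).1 hQ
  obtain ⟨B, hB⟩ := hR.exists_eventually_le hV hα hφ hφ1 hslater hs hQ'.1 hQ'.2 hdom
  rw [utility_eq_coe hV hdom] at hb
  set U : ℝ := ∑ l, (M.V l (M.avgParticipants φ Q l)).toReal with hU
  -- A utility may be `-∞` at 0, so closeness of `y` to the time averages gives no uniform utility
  -- estimate. Instead the tolerance `1 / (k + 1)` is sent to zero along a convergent subsequence.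
  -- The rounds `R k` need not increase.
  have hex : ∀ k : ℕ, ∃ (R : ℕ) (y : L → ℝ), M.utility (M.timeAverage s q R) ≤ b ∧
      (∀ l, y l ∈ effDomain (M.V l) ∧ y l ≤ B) ∧
      U - 1 / ((k : ℝ) + 1) ≤ ∑ l, (M.V l (y l)).toReal ∧
      ∀ l, y l - 1 / ((k : ℝ) + 1) ≤ M.timeAverage s q R l := fun k => by
    obtain ⟨R, h1, y, hy⟩ := (hfreq.and_eventually (hB _ Nat.one_div_pos_of_nat)).exists
    exact ⟨R, y, h1, hy⟩
  choose R y hRb hydom hyU hyle using hex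
  have hbox : ∀ c : ℝ, IsCompact (Set.pi univ fun _ : L => Icc (0 : ℝ) c) := fun c =>
    isCompact_univ_pi fun _ => isCompact_Icc
  obtain ⟨⟨y', a'⟩, hmem, ψ, hψ, hlim⟩ := ((hbox B).prod (hbox (Fintype.card N))).tendsto_subseq
    (x := fun k => (y k, M.timeAverage s q (R k)))
    fun k => ⟨fun l _ => ⟨(hydom k l).1.1, (hydom k l).2⟩, fun l _ => hR.timeAverage_mem _ l⟩
  have hy0 : ∀ l, 0 ≤ y' l := fun l => (hmem.1 l (mem_univ l)).1
  have ha0 : ∀ l, 0 ≤ a' l := fun l => (hmem.2 l (mem_univ l)).1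
  have hylim : Tendsto (fun k => y (ψ k)) atTop (𝓝 y') := (Prod.tendsto_iff _ _).1 hlim |>.1
  have halim : Tendsto (fun k => M.timeAverage s q (R (ψ k))) atTop (𝓝 a') :=
    (Prod.tendsto_iff _ _).1 hlim |>.2
  have hsmall : Tendsto (fun k => 1 / ((ψ k : ℝ) + 1)) atTop (𝓝 0) :=
    tendsto_one_div_add_atTop_nhds_zero_nat.comp hψ.tendsto_atTop
  have hle : ∀ l, y' l ≤ a' l := fun l => by
    have h1 := (tendsto_pi_nhds.1 hylim l).sub hsmall
    rw [sub_zero] at h1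
    exact le_of_tendsto_of_tendsto' h1 (tendsto_pi_nhds.1 halim l) fun k => hyle (ψ k) l
  have hyutil : Tendsto (fun k => M.utility (y (ψ k))) atTop (𝓝 (M.utility y')) :=
    (continuousOn_utility hV _ hy0).tendsto.comp (tendsto_nhdsWithin_iff.2
      ⟨hylim, Eventually.of_forall fun k l => (hydom (ψ k) l).1.1⟩)
  have hautil : Tendsto (fun k => M.utility (M.timeAverage s q (R (ψ k)))) atTop
      (𝓝 (M.utility a')) :=
    (continuousOn_utility hV _ ha0).tendsto.comp (tendsto_nhdsWithin_iff.2
      ⟨halim, Eventually.of_forall fun k l => (hR.timeAverage_mem _ l).1⟩)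
  have h1 : M.utility a' ≤ b := le_of_tendsto' hautil fun k => hRb (ψ k)
  have h2 : (U : EReal) ≤ M.utility y' := by
    have h3 : Tendsto (fun k => ((U - 1 / ((ψ k : ℝ) + 1) : ℝ) : EReal)) atTop (𝓝 (U : EReal)) := by
      have := hsmall.const_sub U
      rw [sub_zero] at this
      exact (continuous_coe_real_ereal.tendsto U).comp this
    refine le_of_tendsto_of_tendsto' h3 hyutil fun k => ?_
    rw [utility_eq_coe hV fun l => (hydom (ψ k) l).1]
    exact EReal.coe_le_coe_iff.2 (hyU (ψ k))
  exact absurd (h2.trans ((utility_mono hV hy0 hle).trans h1)) (not_le.2 hb)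

end IsRun

end TaskModel

theorem theorem1 {N L P Ω : Type*} [Fintype N] [Fintype L] [Fintype P]
    [MeasurableSpace P] [MeasurableSingletonClass P]
    [MeasurableSpace Ω] (μ : Measure Ω) [IsProbabilityMeasure μ]
    (M : TaskModel N L P) (hV : ∀ l, IsUtility (M.V l))
    (S : ℕ → Ω → P) (hS : ∀ r, Measurable (S r)) (hSE : IsStationaryErgodic μ S)
    (φ : P → ℝ) (hφ : ∀ p, φ p = μ.real {ω | S 0 ω = p})
    (hslater : M.IsStrictlyFeasible φ)
    (α : ℕ → ℝ) (hα : IsStepSize α) :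
    ∃ opt : EReal,
      IsGreatest {u | ∃ Q, M.IsRelaxedFeasible φ Q ∧ u = M.utility (M.avgParticipants φ Q)} opt ∧
      (∀ Q, M.IsFeasible φ Q → M.utility (M.avgParticipants φ Q) ≤ opt) ∧
      ∀ᵐ ω ∂μ, ∀ (Y : L → ℝ → ℝ) (lam mu q : ℕ → L → ℝ),
        M.IsRun α (fun r => S r ω) Y lam mu q →
          (∀ l, ∀ ε : ℝ, 0 < ε → ∀ᶠ R in atTop,
            M.X l ≤ ((M.timeAverage (fun r => S r ω) q R l + ε : ℝ) : WithBot ℝ)) ∧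
          Tendsto (fun R => M.utility (M.timeAverage (fun r => S r ω) q R)) atTop (𝓝 opt) := by
  have hφ0 : ∀ p, 0 ≤ φ p := fun p => by
    rw [hφ]
    exact measureReal_nonneg
  have hφ1 : ∑ p, φ p = 1 := by
    have h := sum_measureReal_preimage_singleton (μ := μ) (Finset.univ : Finset P) (f := S 0)
      fun p _ => hS 0 (measurableSet_singleton p)
    simp only [Finset.coe_univ, preimage_univ, probReal_univ] at h
    rw [← h]
    exact Finset.sum_congr rfl fun p _ => hφ p
  obtain ⟨Q, hQ, hdom, hmax⟩ := TaskModel.exists_optimum hV hφ0 hslater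
  refine ⟨M.utility (M.avgParticipants φ Q), ⟨⟨Q, hQ, rfl⟩, ?_⟩, fun Q' hQ' => ?_, ?_⟩
  · rintro _ ⟨Q', hQ', rfl⟩
    exact hmax Q' hQ'
  · exact hmax Q' ⟨fun p => subset_convexHull ℝ _ (hQ'.1 p), hQ'.2⟩
  filter_upwards [ae_blockNull_stateDeviation μ S hS hSE φ hφ] with ω hs Y lam mu q hR
  refine ⟨fun l ε hε => ?_, tendsto_order.2 ⟨fun b hb => ?_, fun b hb => ?_⟩⟩
  · filter_upwards [hR.eventually_minParticipants_le hV hα hφ0 hφ1 hslater hs l hε] with R h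
    exact (M.le_coe_iff (add_nonneg (hR.timeAverage_mem R l).1 hε.le)).2 h
  · exact hR.eventually_lt_utility hV hα hφ0 hφ1 hslater hs hQ hdom hb
  · exact hR.eventually_utility_lt hV hα hφ0 hφ1 hslater hs hmax hb

end
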